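/- Let $M,N\ge 0$ be integers, and for $1\le a\le M+N$ put $[a]=0$ if $a\le M$ and $[a]=1$ if $a>M$. The super Yangian $Y(gl(M|N))$ is the associative unital $\mathbb{C}$-algebra generated by elements $t^a_b[n]$ ($1\le a,b\le M+N$, $n\ge 1$), with $t^a_b[n]$ of parity $[a]+[b]$, subject to the relations, for all $m,n\ge 1$, $$ \begin{aligned} &t^{a_1}_{b_1}[m]\,t^{a_2}_{b_2}[n]-(-1)^{([a_1]+[b_1])([a_2]+[b_2])}\,t^{a_2}_{b_2}[n]\,t^{a_1}_{b_1}[m]\\ &\quad=\delta_{a_2b_1}t^{a_1}_{b_2}[m+n-1]-(-1)^{([a_1]+[b_1])([a_2]+[b_2])}\delta_{a_1b_2}t^{a_2}_{b_1}[m+n-1]\\ &\qquad+(-1)^{\eta}\sum_{r=1}^{\min(m,n)-1}\Bigl(t^{a_2}_{b_1}[r]\,t^{a_1}_{b_2}[m+n-1-r]-t^{a_2}_{b_1}[m+n-1-r]\,t^{a_1}_{b_2}[r]\Bigr), \end{aligned} $$ where $\eta=[a_1][a_2]+[b_1]([a_1]+[a_2])$. Let $\Lambda(x)=(\lambda_1(x),\dots,\lambda_{M+N}(x))$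 with $\lambda_a(x)=(-1)^{[a]}+\sum_{k\ge 1}\lambda_a[k]x^{-k}$ be a tuple of formal power series in $x^{-1}$ with complex coefficients. A vector $v\neq 0$ of a $Y(gl(M|N))$-module is called maximal of weight $\Lambda(x)$ if, for all $n\ge 1$, $t^a_b[n]v=0$ for $a<b$ and $t^a_a[n]v=\lambda_a[n]v$ for all $a$; an irreducible module that contains such a vector is called an irreducible highest weight module with highest weight $\Lambda(x)$. Theorem. For every such $\Lambda(x)$ there exists an irreducible highest weight $Y(gl(M|N))$-module $V(\Lambda)$ with highest weight $\Lambda(x)$, and it is unique up to isomorphism. More precisely, let $\bar V(\Lambda)=Y(gl(M|N))/J_\Lambda$ be the induced (Verma type) module, where $J_\Lambda$ is the left ideal generated by all $t^a_b[n]$ with $a<b$ and all $t^a_a[n]-\lambda_a[n]$, $n\ge 1$. Then $\bar V(\Lambda)$ has a greatest proper submodule $M(\Lambda)$; the quotient $V(\Lambda)=\bar V(\Lambda)/M(\Lambda)$ is irreducible, and the image of $1$ in it is a maximal vector of weight $\Lambda(x)$; every irreducible highest weight $Y(gl(M|N))$-module with highest weight $\Lambda(x)$ is isomorphic to $V(\Lambda)$.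 The same holds for $\mathbb{Z}_2$-graded modules: $V(\Lambda)$ has a $\mathbb{Z}_2$-grading that makes it an irreducible graded module over the superalgebra $Y(gl(M|N))$ and in which the image of $1$ is even, and every irreducible graded module that contains a maximal vector of weight $\Lambda(x)$ is isomorphic to $V(\Lambda)$ by a homogeneous $Y(gl(M|N))$-linear isomorphism, that is, one that either preserves the parity of all homogeneous vectors or reverses it. -/

import Mathlib

universe u

noncomputable section

namespace SuperYangian

/-- The gradation index `[a]` of `a`, as a natural number: the first `M` indices are even (`0`), the
last `N` indices are odd (`1`). The indices `1, …, M+N` are numbered from `0` here. -/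
def par (M N : ℕ) (a : Fin (M + N)) : ℕ := if (a : ℕ) < M then 0 else 1

/-- The modes `t^a_b[n]` in the free algebra. The letter `(a, b, n)` stands for `t^a_b[n+1]`, and
`t^a_b[0] = (-1)^[b] δ_{ab}` is the constant term of the series `t^a_b(u)`. -/
def freeMode (M N : ℕ) (a b : Fin (M + N)) :
    ℕ → FreeAlgebra ℂ (Fin (M + N) × Fin (M + N) × ℕ)
  | 0 => if a = b then algebraMap ℂ _ ((-1) ^ par M N b) else 0
  | n + 1 => FreeAlgebra.ι ℂ (a, b, n)

/-- The defining relations of the super Yangian `Y(gl(M|N))`: the graded commutator of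
`t^{a₁}_{b₁}[m]` and `t^{a₂}_{b₂}[n]` (`m, n > 0`) is

`δ_{a₂ b₁} t^{a₁}_{b₂}[m+n-1] - (-1)^{([a₁]+[b₁])([a₂]+[b₂])} δ_{a₁ b₂} t^{a₂}_{b₁}[m+n-1]`
`+ (-1)^η ∑_{r=1}^{min(m,n)-1} (t^{a₂}_{b₁}[r] t^{a₁}_{b₂}[m+n-1-r]`
`                               - t^{a₂}_{b₁}[m+n-1-r] t^{a₁}_{b₂}[r])`

with `η = [a₁][a₂] + [b₁]([a₁]+[a₂])`. -/
inductive Rel (M N : ℕ) : FreeAlgebra ℂ (Fin (M + N) × Fin (M + N) × ℕ) →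
    FreeAlgebra ℂ (Fin (M + N) × Fin (M + N) × ℕ) → Prop
  | comm (a₁ b₁ a₂ b₂ : Fin (M + N)) (m n : ℕ) (hm : 0 < m) (hn : 0 < n) :
    Rel M N
      (freeMode M N a₁ b₁ m * freeMode M N a₂ b₂ n
        - (-1 : ℂ) ^ ((par M N a₁ + par M N b₁) * (par M N a₂ + par M N b₂)) •
            (freeMode M N a₂ b₂ n * freeMode M N a₁ b₁ m))
      ((if a₂ = b₁ then freeMode M N a₁ b₂ (m + n - 1) else 0)
        - (-1 : ℂ) ^ ((par M N a₁ + par M N b₁) * (par M N a₂ + par M N b₂)) •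
            (if a₁ = b₂ then freeMode M N a₂ b₁ (m + n - 1) else 0)
        + (-1 : ℂ) ^ (par M N a₁ * par M N a₂ + par M N b₁ * (par M N a₁ + par M N a₂)) •
            ∑ r ∈ Finset.Ico 1 (min m n),
              (freeMode M N a₂ b₁ r * freeMode M N a₁ b₂ (m + n - 1 - r)
                - freeMode M N a₂ b₁ (m + n - 1 - r) * freeMode M N a₁ b₂ r))

end SuperYangian

/-- The super Yangian `Y(gl(M|N))`: the associative unital complex algebra with generators
`t^a_b[n]`, `n > 0`, and the relations `SuperYangian.Rel`. -/
def SuperYangian (M N : ℕ) : Type := RingQuot (SuperYangian.Rel M N)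

namespace SuperYangian

instance (M N : ℕ) : Ring (SuperYangian M N) := inferInstanceAs (Ring (RingQuot (Rel M N)))

instance (M N : ℕ) : Algebra ℂ (SuperYangian M N) :=
  inferInstanceAs (Algebra ℂ (RingQuot (Rel M N)))

/-- The quotient map from the free algebra. -/
def mk (M N : ℕ) :
    FreeAlgebra ℂ (Fin (M + N) × Fin (M + N) × ℕ) →ₐ[ℂ] SuperYangian M N :=
  RingQuot.mkAlgHom ℂ (Rel M N)

/-- The element `t^a_b[n]` of `Y(gl(M|N))`; a generator for `n > 0`. -/
def t (M N : ℕ) (a b : Fin (M + N)) (n : ℕ) : SuperYangian M N :=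
  mk M N (freeMode M N a b n)

/-- `v` is a maximal vector with weight `Λ(x) = (λ_1(x), …, λ_{M+N}(x))`. Here `Λ a` is the series
`λ_a` as a formal power series in `x⁻¹`, so that `λ_a[n]` is its `n`-th coefficient. -/
structure IsMaximalVector {M N : ℕ} (Λ : Fin (M + N) → PowerSeries ℂ) {V : Type u}
    [AddCommGroup V] [Module ℂ V] [Module (SuperYangian M N) V] (v : V) : Prop where
  ne_zero : v ≠ 0
  raise : ∀ a b : Fin (M + N), a < b → ∀ n : ℕ, 0 < n → t M N a b n • v = 0
  diag : ∀ (a : Fin (M + N)) (n : ℕ), 0 < n → t M N a a n • v = PowerSeries.coeff n (Λ a) • v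

/-- `V` is an irreducible highest weight module with highest weight `Λ(x)`. -/
structure IsIrreducibleHighestWeight {M N : ℕ} (Λ : Fin (M + N) → PowerSeries ℂ) (V : Type u)
    [AddCommGroup V] [Module ℂ V] [Module (SuperYangian M N) V] : Prop where
  irreducible : IsSimpleModule (SuperYangian M N) V
  exists_maximalVector : ∃ v : V, IsMaximalVector Λ v

/-- The left ideal generated by the `t^a_b[n]`, `a < b`, and the `t^a_a[n] - λ_a[n]`, `n > 0`. -/
def vermaIdeal {M N : ℕ} (Λ : Fin (M + N) → PowerSeries ℂ) :
    Submodule (SuperYangian M N) (SuperYangian M N) :=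
  Submodule.span (SuperYangian M N)
    ({y | ∃ (a b : Fin (M + N)) (n : ℕ), a < b ∧ 0 < n ∧ y = t M N a b n} ∪
      {y | ∃ (a : Fin (M + N)) (n : ℕ), 0 < n ∧
        y = t M N a a n - algebraMap ℂ (SuperYangian M N) (PowerSeries.coeff n (Λ a))})

/-- The Verma type module induced from the one-dimensional space `ℂ v` on which the `t^a_b[n]`,
`a < b`, act by `0` and the `t^a_a[n]` act by `λ_a[n]`. -/
abbrev Verma {M N : ℕ} (Λ : Fin (M + N) → PowerSeries ℂ) : Type :=
  SuperYangian M N ⧸ vermaIdeal Λ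

/-- The sum of all proper submodules of the Verma type module. -/
def vermaMax {M N : ℕ} (Λ : Fin (M + N) → PowerSeries ℂ) :
    Submodule (SuperYangian M N) (Verma Λ) :=
  sSup {P | P ≠ ⊤}

/-- The quotient `V(Λ)` of the Verma type module by the sum of its proper submodules. -/
abbrev IrrepV {M N : ℕ} (Λ : Fin (M + N) → PowerSeries ℂ) : Type := Verma Λ ⧸ vermaMax Λ

/-- The image in `V(Λ)` of the generator `1 ⊗ v` of the Verma type module. -/
def highestVector {M N : ℕ} (Λ : Fin (M + N) → PowerSeries ℂ) : IrrepV Λ :=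
  (vermaMax Λ).mkQ ((vermaIdeal Λ).mkQ 1)

/-- `𝒱` is a `ℤ/2`-grading of the vector space `V` that makes `V` a graded module over the
superalgebra `Y(gl(M|N))`, in which `t^a_b[n]` has degree `[a] + [b]`. -/
structure IsSuperGrading (M N : ℕ) {V : Type u} [AddCommGroup V] [Module ℂ V]
    [Module (SuperYangian M N) V] (𝒱 : ZMod 2 → Submodule ℂ V) : Prop where
  internal : DirectSum.IsInternal 𝒱
  smul_mem : ∀ (a b : Fin (M + N)) (n : ℕ), 0 < n → ∀ (i : ZMod 2) (v : V), v ∈ 𝒱 i →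
    t M N a b n • v ∈ 𝒱 (((par M N a + par M N b : ℕ) : ZMod 2) + i)

/-- `V` with the grading `𝒱` is an irreducible graded module: it is a nonzero graded module, and `0`
and `V` are its only graded submodules. -/
structure IsGradedIrreducible (M N : ℕ) {V : Type u} [AddCommGroup V] [Module ℂ V]
    [Module (SuperYangian M N) V] (𝒱 : ZMod 2 → Submodule ℂ V) : Prop where
  grading : IsSuperGrading M N 𝒱
  nontrivial : Nontrivial V
  eq_bot_or_eq_top : ∀ P : Submodule (SuperYangian M N) V,
    (∀ v ∈ P, ∃ v₀ ∈ P, ∃ v₁ ∈ P, v₀ ∈ 𝒱 0 ∧ v₁ ∈ 𝒱 1 ∧ v = v₀ + v₁) → P = ⊥ ∨ P = ⊤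

end SuperYangian

end

/-!
`V(Λ)` is a quotient of the Verma type module, so there are two things to prove: that the
highest weight space of a module generated by a maximal vector is a line, and that the Verma type
module is not zero.

*The highest weight space.* If `t^a_b[n]` has degree `n`, then by the defining relations generators
commute up to sign and terms of smaller degree. Hence in a word applied to a maximal vector `v` a
letter `t^a_b[n]` with `a ≤ b` can be moved to the right until it meets `v`, and by induction on the
degree only words in the `t^a_b[n]` with `a > b` are needed (`IsMaximalVector.wordSpan_le`). The
element `-∑ a t^a_a[1]` acts on a nonempty such word with an eigenvalue different from the one on
`v`, so a polynomial in it projects any vector to its component in `ℂ v`. Therefore a submodule of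
a module generated by `v` that has a vector with nonzero component in `ℂ v` contains `v`, and the
sum of all proper submodules is proper (`IsMaximalVector.notMem_sSup`). Existence of the greatest
proper submodule, irreducibility and uniqueness follow.

*The Verma type module is not zero.* If `1` were in the left ideal `J_Λ`, this would involve only
finitely many modes, so it is enough to find, for each order `K`, a module with a maximal vector
whose weight agrees with `Λ` up to order `K` (`one_notMem_vermaIdeal`). The modules are tensor
products of oscillator modules. If `σ` is the parity operator, the matrix
`T_{ab}(x) = (-1)^([a][b]) t^a_b(x) σ^[a]` satisfies a relation without parity signs (`IsRTT`), and
this relation is stable under products of matrices with commuting entries (`IsRTT.mul`), so there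
are tensor products of modules. The building blocks are the representations `E_{ij} = x_i ∂_j` of
`gl(M|N)`, for oscillators `x_i` of parity `[i] + [a]`: `x_a` is a bosonic oscillator, and `∂_a`
acts as on `x_a^s`, with `s` an arbitrary complex number; in the maximal vector the oscillators of index
`i > a` are killed by `∂_i`, and those of index `i < a` by `x_i`. Its weight is `1` at the indices
larger than `a`, and `1 + s x` at `a` up to signs. Every polynomial with constant term `1` is a
product of such factors, so the weights can be adjusted one index after the other, starting from
the last (`exists_realizable_trunc`).

*Gradings.* A grading is the eigenspace decomposition of an involution that is semilinear for the
parity automorphism of `Y(gl(M|N))` (`ParityOperator`). The automorphism descends to `V(Λ)`.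
Conversely, if a graded module has a maximal vector, it has a homogeneous one, and if it is
irreducible as a graded module it is irreducible, since the sum of all proper submodules is
stable under the involution. An isomorphism that matches homogeneous maximal vectors is
homogeneous.
-/

noncomputable section

namespace SuperYangian

open Polynomial

variable {M N : ℕ}

/-! ### Generators and relations -/

theorem par_eq_zero_or_one (a : Fin (M + N)) : par M N a = 0 ∨ par M N a = 1 := by
  unfold par; split <;> simp

theorem t_zero (a b : Fin (M + N)) :
    t M N a b 0 = if a = b then algebraMap ℂ _ ((-1) ^ par M N b) else 0 := by
  unfold t; rw [freeMode]; split <;> simp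

/-- The defining relation, solved for the product `t^{a₁}_{b₁}[m] t^{a₂}_{b₂}[n]`. -/
theorem t_mul_t (a₁ b₁ a₂ b₂ : Fin (M + N)) {m n : ℕ} (hm : 0 < m) (hn : 0 < n) :
    t M N a₁ b₁ m * t M N a₂ b₂ n =
      (-1 : ℂ) ^ ((par M N a₁ + par M N b₁) * (par M N a₂ + par M N b₂)) •
          (t M N a₂ b₂ n * t M N a₁ b₁ m)
      + ((if a₂ = b₁ then t M N a₁ b₂ (m + n - 1) else 0)
        - (-1 : ℂ) ^ ((par M N a₁ + par M N b₁) * (par M N a₂ + par M N b₂)) •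
            (if a₁ = b₂ then t M N a₂ b₁ (m + n - 1) else 0)
        + (-1 : ℂ) ^ (par M N a₁ * par M N a₂ + par M N b₁ * (par M N a₁ + par M N a₂)) •
            ∑ r ∈ Finset.Ico 1 (min m n),
              (t M N a₂ b₁ r * t M N a₁ b₂ (m + n - 1 - r)
                - t M N a₂ b₁ (m + n - 1 - r) * t M N a₁ b₂ r)) := by
  have h : mk M N _ = mk M N _ := RingQuot.mkAlgHom_rel ℂ (Rel.comm a₁ b₁ a₂ b₂ m n hm hn)
  simp only [map_sub, map_add, map_mul, map_smul, map_sum, apply_ite (mk M N), map_zero] at h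
  exact (sub_eq_iff_eq_add'.mp h)

@[elab_as_elim]
theorem induction_on {motive : SuperYangian M N → Prop} (y : SuperYangian M N)
    (scalar : ∀ c : ℂ, motive (algebraMap ℂ _ c))
    (gen : ∀ (a b : Fin (M + N)) (n : ℕ), 0 < n → motive (t M N a b n))
    (add : ∀ x y, motive x → motive y → motive (x + y))
    (mul : ∀ x y, motive x → motive y → motive (x * y)) : motive y := by
  obtain ⟨x, rfl⟩ : ∃ x, mk M N x = y := RingQuot.mkAlgHom_surjective ℂ (Rel M N) y
  induction x with
  | grade0 c => simpa using scalar c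
  | grade1 x => exact gen x.1 x.2.1 (x.2.2 + 1) (Nat.succ_pos _)
  | mul x y hx hy => rw [map_mul]; exact mul _ _ hx hy
  | add x y hx hy => rw [map_add]; exact add _ _ hx hy

/-- A family of elements of `A` that satisfies the defining relations gives a homomorphism
`Y(gl(M|N)) → A`. -/
theorem exists_algHom {A : Type*} [Ring A] [Algebra ℂ A] (τ : Fin (M + N) → Fin (M + N) → ℕ → A)
    (h0 : ∀ a b, τ a b 0 = if a = b then algebraMap ℂ A ((-1) ^ par M N b) else 0)
    (h : ∀ (a₁ b₁ a₂ b₂ : Fin (M + N)) (m n : ℕ), 0 < m → 0 < n →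
      τ a₁ b₁ m * τ a₂ b₂ n
        - (-1 : ℂ) ^ ((par M N a₁ + par M N b₁) * (par M N a₂ + par M N b₂)) •
            (τ a₂ b₂ n * τ a₁ b₁ m) =
      (if a₂ = b₁ then τ a₁ b₂ (m + n - 1) else 0)
        - (-1 : ℂ) ^ ((par M N a₁ + par M N b₁) * (par M N a₂ + par M N b₂)) •
            (if a₁ = b₂ then τ a₂ b₁ (m + n - 1) else 0)
        + (-1 : ℂ) ^ (par M N a₁ * par M N a₂ + par M N b₁ * (par M N a₁ + par M N a₂)) •
            ∑ r ∈ Finset.Ico 1 (min m n),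
              (τ a₂ b₁ r * τ a₁ b₂ (m + n - 1 - r) - τ a₂ b₁ (m + n - 1 - r) * τ a₁ b₂ r)) :
    ∃ φ : SuperYangian M N →ₐ[ℂ] A, ∀ a b n, φ (t M N a b n) = τ a b n := by
  let f : FreeAlgebra ℂ (Fin (M + N) × Fin (M + N) × ℕ) →ₐ[ℂ] A :=
    FreeAlgebra.lift ℂ fun x => τ x.1 x.2.1 (x.2.2 + 1)
  have hf : ∀ a b n, f (freeMode M N a b n) = τ a b n := by
    intro a b n
    cases n with
    | zero => rw [h0, freeMode]; split <;> simp
    | succ n => simp [freeMode, f]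
  have hrel : ∀ ⦃x y⦄, Rel M N x y → f x = f y := by
    rintro _ _ ⟨a₁, b₁, a₂, b₂, m, n, hm, hn⟩
    simp only [map_sub, map_add, map_mul, map_smul, map_sum, apply_ite f, map_zero, hf]
    exact h a₁ b₁ a₂ b₂ m n hm hn
  exact ⟨RingQuot.liftAlgHom ℂ ⟨f, hrel⟩, fun a b n =>
    (RingQuot.liftAlgHom_mkAlgHom_apply ℂ f hrel _).trans (hf a b n)⟩

/-! ### The weight decomposition of a highest weight module -/

section HighestWeight

variable {V : Type u} [AddCommGroup V] [Module ℂ V] [Module (SuperYangian M N) V]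

/-- The product of the generators `t^a_b[n+1]` over the letters `(a, b, n)` of a word. -/
def word (l : List (Fin (M + N) × Fin (M + N) × ℕ)) : SuperYangian M N :=
  (l.map fun x => t M N x.1 x.2.1 (x.2.2 + 1)).prod

/-- The degree of a word for the filtration in which `t^a_b[n]` has degree `n`. For this filtration
the associated graded algebra is supercommutative. -/
def wordDegree (l : List (Fin (M + N) × Fin (M + N) × ℕ)) : ℕ :=
  (l.map fun x => x.2.2 + 1).sum

/-- The span of the vectors `w • v` for the words `w` of degree at most `d`. -/
def wordSpan (v : V) (d : ℕ) : Submodule ℂ V :=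
  Submodule.span ℂ {x | ∃ l : List (Fin (M + N) × Fin (M + N) × ℕ),
    wordDegree l ≤ d ∧ x = word l • v}

@[simp] theorem word_nil : word ([] : List (Fin (M + N) × Fin (M + N) × ℕ)) = 1 := rfl

@[simp] theorem word_cons (x : Fin (M + N) × Fin (M + N) × ℕ) (l) :
    word (x :: l) = t M N x.1 x.2.1 (x.2.2 + 1) * word l := by simp [word]

@[simp] theorem wordDegree_nil :
    wordDegree ([] : List (Fin (M + N) × Fin (M + N) × ℕ)) = 0 := rfl

@[simp] theorem wordDegree_cons (x : Fin (M + N) × Fin (M + N) × ℕ) (l) :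
    wordDegree (x :: l) = x.2.2 + 1 + wordDegree l := by simp [wordDegree]

theorem word_smul_mem_wordSpan (v : V) {l : List (Fin (M + N) × Fin (M + N) × ℕ)} {d : ℕ}
    (h : wordDegree l ≤ d) : word l • v ∈ wordSpan (M := M) (N := N) v d :=
  Submodule.subset_span ⟨l, h, rfl⟩

theorem wordSpan_mono (v : V) {d e : ℕ} (h : d ≤ e) :
    wordSpan (M := M) (N := N) v d ≤ wordSpan (M := M) (N := N) v e :=
  Submodule.span_mono fun _ ⟨l, hl, hx⟩ => ⟨l, hl.trans h, hx⟩

variable [IsScalarTower ℂ (SuperYangian M N) V]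

theorem t_smul_mem_wordSpan {v : V} {d e : ℕ} (a b : Fin (M + N)) (n : ℕ) {x : V}
    (hx : x ∈ wordSpan (M := M) (N := N) v d) (h : n + d ≤ e) :
    t M N a b n • x ∈ wordSpan (M := M) (N := N) v e := by
  refine wordSpan_mono v h ?_
  cases n with
  | zero =>
    rw [t_zero]
    split
    · rw [algebraMap_smul, zero_add]; exact Submodule.smul_mem _ _ hx
    · rw [zero_smul]; exact Submodule.zero_mem _
  | succ n =>
    induction hx using Submodule.span_induction with
    | mem x hx =>
      obtain ⟨l, hl, rfl⟩ := hx
      rw [smul_smul, ← word_cons (a, b, n) l]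
      exact word_smul_mem_wordSpan v (by simp; omega)
    | zero => simp
    | add x y _ _ hx hy => rw [smul_add]; exact Submodule.add_mem _ hx hy
    | smul c x _ hx => rw [smul_comm]; exact Submodule.smul_mem _ _ hx

/-- Two generators commute up to a sign and up to terms of smaller degree. -/
theorem t_smul_t_smul_mem_wordSpan {v : V} {d e : ℕ} (a₁ b₁ a₂ b₂ : Fin (M + N)) {m n : ℕ}
    (hm : 0 < m) (hn : 0 < n) {x : V} (hx : x ∈ wordSpan (M := M) (N := N) v d)
    (h : m + n - 1 + d ≤ e)
    (hswap : t M N a₂ b₂ n • t M N a₁ b₁ m • x ∈ wordSpan (M := M) (N := N) v e) :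
    t M N a₁ b₁ m • t M N a₂ b₂ n • x ∈ wordSpan (M := M) (N := N) v e := by
  rw [smul_smul, t_mul_t a₁ b₁ a₂ b₂ hm hn]
  simp only [add_smul, sub_smul, smul_assoc, Finset.sum_smul, mul_smul, ite_smul, zero_smul]
  have h2 : ∀ (a b c e' : Fin (M + N)) (p q : ℕ), p + q = m + n - 1 →
      t M N a b p • t M N c e' q • x ∈ wordSpan (M := M) (N := N) v e := fun a b c e' p q hpq =>
    t_smul_mem_wordSpan a b p (t_smul_mem_wordSpan c e' q hx le_rfl) (by omega)
  have h1 : ∀ a b : Fin (M + N),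
      t M N a b (m + n - 1) • x ∈ wordSpan (M := M) (N := N) v e := fun a b =>
    t_smul_mem_wordSpan a b _ hx h
  refine Submodule.add_mem _ (Submodule.smul_mem _ _ hswap) (Submodule.add_mem _
    (Submodule.sub_mem _ ?_ (Submodule.smul_mem _ _ ?_))
    (Submodule.smul_mem _ _ (Submodule.sum_mem _ fun r hr => ?_)))
  · split
    · exact h1 _ _
    · exact Submodule.zero_mem _
  · split
    · exact h1 _ _
    · exact Submodule.zero_mem _
  · rw [Finset.mem_Ico] at hr
    exact Submodule.sub_mem _ (h2 _ _ _ _ _ _ (by omega)) (h2 _ _ _ _ _ _ (by omega))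

variable {Λ : Fin (M + N) → PowerSeries ℂ} {v : V}

/-- A generator that is not lowering can be moved to the right through a word, where it meets the
maximal vector; so it raises the degree by less than its own degree. -/
theorem IsMaximalVector.t_smul_word_mem (hv : IsMaximalVector Λ v) {a b : Fin (M + N)} (hab : a ≤ b)
    {n : ℕ} (hn : 0 < n) (l : List (Fin (M + N) × Fin (M + N) × ℕ)) :
    t M N a b n • word l • v ∈ wordSpan (M := M) (N := N) v (n + wordDegree l - 1) := by
  induction l with
  | nil =>
    rw [word_nil, one_smul]
    have hmem : v ∈ wordSpan (M := M) (N := N) v (n + wordDegree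
        ([] : List (Fin (M + N) × Fin (M + N) × ℕ)) - 1) := by
      simpa using word_smul_mem_wordSpan (M := M) (N := N) v (l := []) (Nat.zero_le _)
    rcases hab.lt_or_eq with hab | rfl
    · rw [hv.raise a b hab n hn]; exact Submodule.zero_mem _
    · rw [hv.diag a n hn]; exact Submodule.smul_mem _ _ hmem
  | cons x l ih =>
    rw [word_cons, mul_smul]
    have hl := word_smul_mem_wordSpan (M := M) (N := N) v (le_refl (wordDegree l))
    refine t_smul_t_smul_mem_wordSpan a b x.1 x.2.1 hn x.2.2.succ_pos hl ?_ ?_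
    · simp; omega
    · exact t_smul_mem_wordSpan _ _ _ ih (by simp; omega)

theorem IsMaximalVector.word_smul_mem_of_not_lowering (hv : IsMaximalVector Λ v)
    (l : List (Fin (M + N) × Fin (M + N) × ℕ)) (hl : ∃ x ∈ l, x.1 ≤ x.2.1) :
    0 < wordDegree l ∧ word l • v ∈ wordSpan (M := M) (N := N) v (wordDegree l - 1) := by
  induction l with
  | nil => simp at hl
  | cons x l ih =>
    refine ⟨by simp, ?_⟩
    rw [word_cons, mul_smul]
    by_cases hx : x.1 ≤ x.2.1
    · simpa using hv.t_smul_word_mem hx x.2.2.succ_pos l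
    · obtain ⟨hpos, hmem⟩ := ih (by simpa [hx] using hl)
      exact t_smul_mem_wordSpan _ _ _ hmem (by simp; omega)

/-- The element `-∑ a t^a_a[1]`, whose adjoint action multiplies `t^a_b[n]` by `b - a`. -/
def grading (M N : ℕ) : SuperYangian M N :=
  ∑ c : Fin (M + N), (-(c : ℂ)) • t M N c c 1

theorem grading_mul_t (a b : Fin (M + N)) {n : ℕ} (hn : 0 < n) :
    grading M N * t M N a b n =
      t M N a b n * grading M N + ((b : ℂ) - (a : ℂ)) • t M N a b n := by
  have key : ∀ c : Fin (M + N), t M N c c 1 * t M N a b n = t M N a b n * t M N c c 1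
      + ((if a = c then t M N a b n else 0) - if c = b then t M N a b n else 0) := by
    intro c
    have hs : (-1 : ℂ) ^ ((par M N c + par M N c) * (par M N a + par M N b)) = 1 := by
      rw [← two_mul, mul_assoc, pow_mul]; simp
    have hmin : Finset.Ico 1 (min 1 n) = ∅ := by simp
    rw [t_mul_t c c a b one_pos hn, hs, hmin]
    simp only [one_smul, Finset.sum_empty, smul_zero, add_zero, Nat.add_sub_cancel_left]
    congr 2
    · split_ifs with h
      · rw [h]
      · rfl
    · split_ifs with h
      · rw [h]
      · rfl
  simp only [grading, Finset.sum_mul, Finset.mul_sum, smul_mul_assoc, key, smul_add, smul_sub,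
    smul_ite, smul_zero, Finset.sum_add_distrib, Finset.sum_sub_distrib, Finset.sum_ite_eq,
    Finset.sum_ite_eq', Finset.mem_univ, if_true, mul_smul_comm]
  module

/-- The complement, in a highest weight module, of the weight space of weight `μ`: the sum of the
generalized eigenspaces of the grading element for the eigenvalues other than `μ`. -/
def complement (M N : ℕ) (V : Type u) [AddCommGroup V] [Module ℂ V] [Module (SuperYangian M N) V]
    [IsScalarTower ℂ (SuperYangian M N) V] (μ : ℂ) : Submodule ℂ V where
  carrier := {x | ∃ q : ℂ[X], q.eval μ ≠ 0 ∧ aeval (grading M N) q • x = 0}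
  zero_mem' := ⟨1, by simp, by simp⟩
  add_mem' := by
    rintro x y ⟨p, hp, hpx⟩ ⟨q, hq, hqy⟩
    refine ⟨p * q, by simp [hp, hq], ?_⟩
    rw [smul_add, map_mul, mul_smul _ _ y, hqy, ← map_mul, mul_comm p q, map_mul, mul_smul, hpx]
    simp
  smul_mem' := by
    rintro c x ⟨p, hp, hpx⟩
    exact ⟨p, hp, by rw [smul_comm, hpx, smul_zero]⟩

theorem aeval_smul_of_smul_eq {y : SuperYangian M N} {x : V}
    {μ : ℂ} (h : y • x = μ • x) (q : ℂ[X]) : aeval y q • x = q.eval μ • x := by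
  induction q using Polynomial.induction_on' with
  | add p q hp hq => simp [add_smul, hp, hq]
  | monomial n c =>
    have hpow : y ^ n • x = μ ^ n • x := by
      induction n with
      | zero => simp
      | succ n ih => rw [pow_succ, mul_smul, h, smul_comm, ih, smul_smul, pow_succ, mul_comm]
    rw [aeval_monomial, mul_smul, hpow, algebraMap_smul, smul_smul, eval_monomial]

/-- The eigenvalue of the grading element on a maximal vector of weight `Λ`. -/
def gradingWeight (Λ : Fin (M + N) → PowerSeries ℂ) : ℂ :=
  ∑ c : Fin (M + N), -(c : ℂ) * PowerSeries.coeff 1 (Λ c)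

theorem IsMaximalVector.grading_smul (hv : IsMaximalVector Λ v) :
    grading M N • v = gradingWeight Λ • v := by
  simp only [grading, gradingWeight, Finset.sum_smul, smul_assoc, hv.diag _ 1 one_pos, smul_smul]

theorem IsMaximalVector.notMem_complement (hv : IsMaximalVector Λ v) :
    v ∉ complement M N V (gradingWeight Λ) := by
  rintro ⟨q, hq, h⟩
  rw [aeval_smul_of_smul_eq hv.grading_smul] at h
  exact (smul_eq_zero.mp h).elim hq hv.ne_zero

theorem IsMaximalVector.exists_grading_smul_lowering (hv : IsMaximalVector Λ v)
    (l : List (Fin (M + N) × Fin (M + N) × ℕ)) (hl : ∀ x ∈ l, x.2.1 < x.1) :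
    ∃ k : ℕ, l.length ≤ k ∧
      grading M N • word l • v = (gradingWeight Λ - k) • word l • v := by
  induction l with
  | nil => exact ⟨0, le_rfl, by simp [hv.grading_smul]⟩
  | cons x l ih =>
    obtain ⟨k, hk, ih⟩ := ih fun y hy => hl y (List.mem_cons_of_mem _ hy)
    have hx := hl x List.mem_cons_self
    rw [Fin.lt_def] at hx
    refine ⟨k + (x.1 - x.2.1 : ℕ), by simp; omega, ?_⟩
    rw [word_cons, mul_smul, smul_smul, grading_mul_t _ _ x.2.2.succ_pos, add_smul, mul_smul, ih,
      smul_assoc, smul_comm _ (_ : ℂ), ← add_smul, Nat.cast_add, Nat.cast_sub hx.le]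
    congr 1; ring

/-- A word with a letter that is not lowering reduces to words of smaller degree, and a nonempty
word in lowering letters is an eigenvector of the grading element that lies in the complement. -/
theorem IsMaximalVector.wordSpan_le (hv : IsMaximalVector Λ v) (d : ℕ) :
    wordSpan (M := M) (N := N) v d ≤
      Submodule.span ℂ {v} ⊔ complement M N V (gradingWeight Λ) := by
  induction d using Nat.strong_induction_on with
  | _ d ih =>
    refine Submodule.span_le.mpr ?_
    rintro _ ⟨l, hl, rfl⟩
    by_cases h : ∃ x ∈ l, x.1 ≤ x.2.1
    · obtain ⟨hpos, hmem⟩ := hv.word_smul_mem_of_not_lowering l h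
      exact ih _ (by omega) hmem
    · push Not at h
      obtain ⟨k, hk, hkl⟩ := hv.exists_grading_smul_lowering l h
      cases l with
      | nil =>
        rw [word_nil, one_smul]
        exact Submodule.mem_sup_left (Submodule.mem_span_singleton_self v)
      | cons x l =>
        refine Submodule.mem_sup_right ⟨X - C (gradingWeight Λ - k), ?_, ?_⟩
        · have : (k : ℂ) ≠ 0 := by
            rw [Nat.cast_ne_zero]; simp at hk; omega
          simpa using this
        · rw [aeval_smul_of_smul_eq hkl]; simp

theorem IsMaximalVector.smul_mem (hv : IsMaximalVector Λ v) (y : SuperYangian M N) :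
    y • v ∈ Submodule.span ℂ {v} ⊔ complement M N V (gradingWeight Λ) := by
  suffices h : ∀ (x : V) (d : ℕ), x ∈ wordSpan (M := M) (N := N) v d →
      ∃ e, y • x ∈ wordSpan (M := M) (N := N) v e by
    have hv0 := word_smul_mem_wordSpan (M := M) (N := N) v (l := []) le_rfl
    rw [word_nil, one_smul] at hv0
    obtain ⟨e, he⟩ := h v _ hv0
    exact hv.wordSpan_le e he
  induction y using induction_on with
  | scalar c => exact fun x d hx => ⟨d, by rw [algebraMap_smul]; exact Submodule.smul_mem _ _ hx⟩
  | gen a b n hn => exact fun x d hx => ⟨_, t_smul_mem_wordSpan a b n hx le_rfl⟩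
  | add y z hy hz =>
    intro x d hx
    obtain ⟨e, he⟩ := hy x d hx
    obtain ⟨f, hf⟩ := hz x d hx
    refine ⟨max e f, ?_⟩
    rw [add_smul]
    exact Submodule.add_mem _ (wordSpan_mono v (le_max_left _ _) he)
      (wordSpan_mono v (le_max_right _ _) hf)
  | mul y z hy hz =>
    intro x d hx
    obtain ⟨e, he⟩ := hz x d hx
    rw [mul_smul]
    exact hy _ e he

/-- In a module generated by a maximal vector every proper submodule lies in the complement of its
weight space. -/
theorem IsMaximalVector.mem_complement_of_mem (hv : IsMaximalVector Λ v)
    (hgen : ∀ x : V, ∃ y : SuperYangian M N, y • v = x)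
    {P : Submodule (SuperYangian M N) V} (hP : P ≠ ⊤) {x : V} (hx : x ∈ P) :
    x ∈ complement M N V (gradingWeight Λ) := by
  obtain ⟨y, rfl⟩ := hgen x
  obtain ⟨u, hu, w, ⟨q, hq, hw⟩, huw⟩ := Submodule.mem_sup.mp (hv.smul_mem y)
  obtain ⟨c, rfl⟩ := Submodule.mem_span_singleton.mp hu
  by_cases hc : c = 0
  · rw [← huw, hc, zero_smul, zero_add]; exact ⟨q, hq, hw⟩
  · -- The polynomial `q` of the grading element projects `x` to a nonzero multiple of `v`.
    refine absurd (top_unique fun z _ => ?_) hP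
    obtain ⟨y', rfl⟩ := hgen z
    have h := P.smul_mem (aeval (grading M N) q) hx
    rw [← huw, smul_add, hw, add_zero, smul_comm, aeval_smul_of_smul_eq hv.grading_smul,
      smul_smul] at h
    have h' := P.smul_of_tower_mem (c * q.eval (gradingWeight Λ))⁻¹ h
    rw [smul_smul, inv_mul_cancel₀ (mul_ne_zero hc hq), one_smul] at h'
    exact P.smul_mem y' h'

/-- The sum of the proper submodules of a module generated by a maximal vector is proper. -/
theorem IsMaximalVector.notMem_sSup (hv : IsMaximalVector Λ v)
    (hgen : ∀ x : V, ∃ y : SuperYangian M N, y • v = x) :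
    v ∉ sSup {P : Submodule (SuperYangian M N) V | P ≠ ⊤} := by
  intro h
  rw [sSup_eq_iSup'] at h
  refine hv.notMem_complement (Submodule.iSup_induction _
    (motive := fun x => x ∈ complement M N V (gradingWeight Λ)) h ?_ ?_ ?_)
  · exact fun P x hx => hv.mem_complement_of_mem hgen P.2 hx
  · exact Submodule.zero_mem _
  · exact fun x y hx hy => Submodule.add_mem _ hx hy

end HighestWeight

/-! ### The defining relation without superalgebra signs -/

/-- The sign `(-1)^([a][b])`. -/
def sgn (a b : Fin (M + N)) : ℤ := (-1) ^ (par M N a * par M N b)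

/-- The relation
`(y - x) (θ_{ik} T_{ij}(x) T_{kl}(y) - θ_{jl} T_{kl}(y) T_{ij}(x))`
`= x y (T_{kj}(x) T_{il}(y) - T_{kj}(y) T_{il}(x))`, `θ_{ik} = (-1)^{[i][k]}`,
for a matrix of polynomials in a central variable, `x` and `y` being the inner and the outer
variable of `R[X][X]`. It involves no parities of the entries of `T`. -/
def IsRTT {R : Type*} [Ring R] (T : Fin (M + N) → Fin (M + N) → R[X]) : Prop :=
  ∀ i j k l, (X - C X : R[X][X]) * (sgn i k • (C (T i j) * (T k l).map C)
      - sgn j l • ((T k l).map C * C (T i j))) =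
    (C X * X) * (C (T k j) * (T i l).map C - (T k j).map C * C (T i l))

section Product

variable {ι S : Type*} [Fintype ι] [Ring S]

/-- The two sides of an RTT relation are stable under products of matrices with mutually commuting
entries; `δ` and `ε` stand for `y - x` and `x y`. -/
theorem rtt_mul (δ ε : S) (hδ : ∀ s, Commute δ s) (hε : ∀ s, Commute ε s) (θ : ι → ι → ℤ)
    (A A' B B' : ι → ι → S) (hBA' : ∀ i j k l, Commute (B i j) (A' k l))
    (hB'A : ∀ i j k l, Commute (B' i j) (A k l))
    (hA : ∀ i j k l, δ * (θ i k • (A i j * A' k l) - θ j l • (A' k l * A i j)) =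
      ε * (A k j * A' i l - A' k j * A i l))
    (hB : ∀ i j k l, δ * (θ i k • (B i j * B' k l) - θ j l • (B' k l * B i j)) =
      ε * (B k j * B' i l - B' k j * B i l)) (i j k l : ι) :
    δ * (θ i k • ((∑ c, A i c * B c j) * ∑ d, A' k d * B' d l)
        - θ j l • ((∑ d, A' k d * B' d l) * ∑ c, A i c * B c j)) =
      ε * ((∑ c, A k c * B c j) * (∑ d, A' i d * B' d l)
        - (∑ c, A' k c * B' c j) * ∑ d, A i d * B d l) := by
  have comm : ∀ a c b d e f g h, A a c * B c b * (A' d e * B' f g) * h =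
      A a c * A' d e * (B c b * B' f g) * h := by
    intro a c b d e f g h
    rw [mul_assoc (A a c), ← mul_assoc (B c b), (hBA' c b d e).eq]; simp only [mul_assoc]
  have comm' : ∀ a c b d e f g h, A' d e * B' f g * (A a c * B c b) * h =
      A' d e * A a c * (B' f g * B c b) * h := by
    intro a c b d e f g h
    rw [mul_assoc (A' d e), ← mul_assoc (B' f g), (hB'A f g a c).eq]; simp only [mul_assoc]
  -- The relation for `A` and `B` is applied to the factors of one summand; the terms that are left
  -- over cancel in the sum after exchanging the summation indices `c` and `d`.
  have term : ∀ c d, δ * (θ i k • (A i c * B c j * (A' k d * B' d l))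
      - θ j l • (A' k d * B' d l * (A i c * B c j))) =
      ε * (A k c * B c j * (A' i d * B' d l)) - ε * (A' k c * A i d * (B c j * B' d l))
      + (ε * (A' k d * A i c * (B d j * B' c l)) - ε * (A' k d * B' d j * (A i c * B c l))) := by
    intro c d
    have e1 := congrArg (· * (B c j * B' d l)) (hA i c k d)
    have e2 := congrArg (A' k d * A i c * ·) (hB c j d l)
    simp only [← mul_assoc (A' k d * A i c) δ, ← mul_assoc (A' k d * A i c) ε,
      ← (hδ (A' k d * A i c)).eq, ← (hε (A' k d * A i c)).eq] at e2
    have c1 := comm i c j k d d l 1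
    have c2 := comm' i c j k d d l 1
    have c3 := comm k c j i d d l 1
    have c4 := comm' i c l k d d j 1
    simp only [mul_one] at c1 c2 c3 c4
    rw [c1, c2, c3, c4]
    simp only [mul_sub, sub_mul, mul_smul_comm, smul_mul_assoc, mul_assoc] at e1 e2 ⊢
    rw [sub_eq_iff_eq_add] at e1 e2
    rw [e1, e2]
    abel
  have swap : ∀ f : ι → ι → S, ∑ c, ∑ d, f d c = ∑ c, ∑ d, f c d := fun f => Finset.sum_comm
  have flip : (∑ d, A' k d * B' d l) * ∑ c, A i c * B c j =
      ∑ c, ∑ d, A' k d * B' d l * (A i c * B c j) := by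
    rw [Finset.sum_mul_sum, Finset.sum_comm]
  rw [flip, Finset.sum_mul_sum, Finset.sum_mul_sum, Finset.sum_mul_sum]
  simp only [Finset.smul_sum, ← Finset.sum_sub_distrib]
  simp only [Finset.mul_sum, term]
  simp only [Finset.sum_add_distrib, Finset.sum_sub_distrib, mul_sub]
  rw [swap fun c d => ε * (A' k c * A i d * (B c j * B' d l)),
    swap fun c d => ε * (A' k c * B' c j * (A i d * B d l))]
  abel

end Product


theorem coeff_coeff_C_mul_map_C {R : Type*} [Ring R] (p q : R[X]) (m n : ℕ) :
    ((C p * q.map C).coeff n).coeff m = p.coeff m * q.coeff n := by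
  rw [coeff_C_mul, coeff_map, coeff_mul_C]

theorem coeff_coeff_map_C_mul_C {R : Type*} [Ring R] (p q : R[X]) (m n : ℕ) :
    ((q.map C * C p).coeff n).coeff m = q.coeff n * p.coeff m := by
  rw [coeff_mul_C, coeff_map, coeff_C_mul]

theorem commute_C_map_C {R : Type*} [Ring R] {p q : R[X]}
    (h : ∀ m n, Commute (p.coeff m) (q.coeff n)) : Commute (C p) (q.map C) := by
  ext n m
  rw [coeff_coeff_C_mul_map_C, coeff_coeff_map_C_mul_C, (h m n).eq]

theorem commute_X_sub_C_X {R : Type*} [Ring R] (p : R[X][X]) :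
    Commute (X - C X : R[X][X]) p := by
  refine (commute_X p).sub_left ?_
  ext n m
  rw [coeff_C_mul, coeff_mul_C, X_mul]

theorem commute_C_X_mul_X {R : Type*} [Ring R] (p : R[X][X]) :
    Commute (C X * X : R[X][X]) p := by
  refine Commute.mul_left ?_ (commute_X p)
  ext n m
  rw [coeff_C_mul, coeff_mul_C, X_mul]

/-- The product of two matrices whose entries commute with each other inherits the RTT relation.
This is the comultiplication of the Yangian. -/
theorem IsRTT.mul {R : Type*} [Ring R] {A B : Fin (M + N) → Fin (M + N) → R[X]}
    (hA : IsRTT A) (hB : IsRTT B)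
    (hAB : ∀ i j k l m n, Commute ((A i j).coeff m) ((B k l).coeff n)) :
    IsRTT fun i j => ∑ c, A i c * B c j := by
  intro i j k l
  simp only [map_sum, Polynomial.map_sum, map_mul, Polynomial.map_mul]
  exact rtt_mul (X - C X) (C X * X) commute_X_sub_C_X commute_C_X_mul_X sgn
    (fun i j => C (A i j)) (fun i j => (A i j).map C) (fun i j => C (B i j))
    (fun i j => (B i j).map C)
    (fun i j k l => commute_C_map_C fun m n => (hAB _ _ _ _ _ _).symm)
    (fun i j k l => (commute_C_map_C fun m n => hAB _ _ _ _ _ _).symm) hA hB i j k l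

theorem IsRTT.map {R S : Type*} [Ring R] [Ring S] (f : R →+* S)
    {A : Fin (M + N) → Fin (M + N) → R[X]} (hA : IsRTT A) :
    IsRTT fun i j => (A i j).map f := by
  intro i j k l
  have h := congrArg (Polynomial.map (Polynomial.mapRingHom f)) (hA i j k l)
  have e : ∀ p : R[X], (p.map C).map (mapRingHom f) = (p.map f).map C := by
    intro p
    rw [Polynomial.map_map, Polynomial.map_map]
    congr 1
    ext; simp
  have hz : ∀ (z : ℤ) (p : R[X][X]), (z • p).map (mapRingHom f) = z • p.map (mapRingHom f) :=
    fun z p => map_zsmul (mapRingHom (mapRingHom f)) z p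
  simpa only [Polynomial.map_mul, Polynomial.map_sub, hz, map_X, map_C, e,
    coe_mapRingHom] using h

section Modes

variable {R : Type*} [Ring R] (T : Fin (M + N) → Fin (M + N) → R[X])

/-- The coefficient of `x^m y^n` in `θ_{ik} T_{ij}(x) T_{kl}(y) - θ_{jl} T_{kl}(y) T_{ij}(x)`. -/
def lhsMode (i j k l : Fin (M + N)) (m n : ℕ) : R :=
  sgn i k • ((T i j).coeff m * (T k l).coeff n) - sgn j l • ((T k l).coeff n * (T i j).coeff m)

/-- The coefficient of `x^m y^n` in `T_{kj}(x) T_{il}(y) - T_{kj}(y) T_{il}(x)`. -/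
def rhsMode (i j k l : Fin (M + N)) (m n : ℕ) : R :=
  (T k j).coeff m * (T i l).coeff n - (T k j).coeff n * (T i l).coeff m

theorem isRTT_iff : IsRTT T ↔ ∀ i j k l,
    (∀ n, lhsMode T i j k l 0 n = 0) ∧ (∀ m, lhsMode T i j k l m 0 = 0) ∧
    ∀ m n, lhsMode T i j k l (m + 1) n - lhsMode T i j k l m (n + 1) = rhsMode T i j k l m n := by
  unfold IsRTT
  refine forall_congr' fun i => forall_congr' fun j => forall_congr' fun k =>
    forall_congr' fun l => ?_
  set P : R[X][X] := sgn i k • (C (T i j) * (T k l).map C)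
      - sgn j l • ((T k l).map C * C (T i j)) with hP
  set Q : R[X][X] := C (T k j) * (T i l).map C - (T k j).map C * C (T i l) with hQ
  have cP : ∀ m n, (P.coeff n).coeff m = lhsMode T i j k l m n := by
    intro m n
    simp only [hP, coeff_sub, coeff_smul, coeff_coeff_C_mul_map_C, coeff_coeff_map_C_mul_C,
      lhsMode]
  have cQ : ∀ m n, (Q.coeff n).coeff m = rhsMode T i j k l m n := by
    intro m n
    simp only [hQ, coeff_sub, coeff_coeff_C_mul_map_C, coeff_coeff_map_C_mul_C, rhsMode]
  simp only [← cP, ← cQ]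
  constructor
  · intro h
    have hc := fun m n => congrArg (fun p : R[X][X] => (p.coeff n).coeff m) h
    refine ⟨fun n => ?_, fun m => ?_, fun m n => ?_⟩
    · simpa [sub_mul, mul_assoc] using hc 0 (n + 1)
    · simpa [sub_mul, mul_assoc] using hc (m + 1) 0
    · simpa [sub_mul, mul_assoc] using hc (m + 1) (n + 1)
  · rintro ⟨h0, h1, h2⟩
    ext n m
    rcases n with _ | n <;> rcases m with _ | m <;> simp [sub_mul, mul_assoc, h0, h1, h2]

variable {T}

/-- The closed form of the relation between two modes. -/
theorem IsRTT.lhsMode_eq (h : IsRTT T) (i j k l : Fin (M + N)) (m n : ℕ) :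
    lhsMode T i j k l m n =
      ∑ r ∈ Finset.range (min m n), rhsMode T i j k l r (m + n - 1 - r) := by
  obtain ⟨h0, h1, h2⟩ := (isRTT_iff T).mp h i j k l
  have left : ∀ m n, lhsMode T i j k l m n =
      ∑ r ∈ Finset.range m, rhsMode T i j k l r (m + n - 1 - r) := by
    intro m
    induction m with
    | zero => simp [h0]
    | succ m ih =>
      intro n
      rw [Finset.sum_range_succ, eq_add_of_sub_eq (h2 m n), ih, add_comm]
      congr 1
      · refine Finset.sum_congr rfl fun r _ => ?_
        congr 1; omega
      · congr 1; omega
  -- The recursion can be run in either index, since `rhsMode` is antisymmetric in the two modes.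
  have right : ∀ n m, lhsMode T i j k l m n =
      ∑ r ∈ Finset.range n, rhsMode T i j k l r (m + n - 1 - r) := by
    intro n
    induction n with
    | zero => simp [h1]
    | succ n ih =>
      intro m
      have e := h2 m n
      have anti : rhsMode T i j k l m n = - rhsMode T i j k l n m := by simp [rhsMode]
      rw [Finset.sum_range_succ, ← sub_eq_iff_eq_add.mpr (sub_eq_iff_eq_add'.mp e), ih, anti,
        sub_neg_eq_add]
      congr 1
      · refine Finset.sum_congr rfl fun r _ => ?_
        congr 1; omega
      · congr 1; omega
  rcases le_total m n with h | h
  · rw [min_eq_left h]; exact left m n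
  · rw [min_eq_right h]; exact right n m

end Modes

/-! ### Realizations of weights -/

theorem neg_one_pow_congr {p q : ℕ} (h : Even (p + q)) : (-1 : ℂ) ^ p = (-1) ^ q := by
  rcases Nat.even_or_odd q with hq | hq
  · rw [hq.neg_one_pow, ((Nat.even_add.mp h).mpr hq).neg_one_pow]
  · have hp : Odd p := by
      rw [← Nat.not_even_iff_odd] at hq ⊢
      exact fun hp => hq ((Nat.even_add.mp h).mp hp)
    rw [hq.neg_one_pow, hp.neg_one_pow]

/-- `V` carries a parity operator `σ` and a matrix `T` with the RTT relation, and `v` is an even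
vector that is maximal for `T`, with weight `μ`. The action of `Y(gl(M|N))` on `V` is given by
`t^a_b(x) = (-1)^([a][b]) T_{ab}(x) σ^[a]`. -/
structure IsRealization {V : Type*} [AddCommGroup V] [Module ℂ V] (σ : Module.End ℂ V)
    (T : Fin (M + N) → Fin (M + N) → (Module.End ℂ V)[X]) (v : V)
    (μ : Fin (M + N) → ℂ[X]) : Prop where
  sq : σ * σ = 1
  rtt : IsRTT T
  parity : ∀ i j n, σ * (T i j).coeff n =
    (-1 : ℂ) ^ (par M N i + par M N j) • ((T i j).coeff n * σ)
  coeff_zero : ∀ i j, (T i j).coeff 0 = if i = j then σ ^ par M N i else 0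
  ne_zero : v ≠ 0
  even : σ v = v
  raise : ∀ i j, i < j → ∀ n, (T i j).coeff n v = 0
  diag : ∀ i n, (T i i).coeff n v = (μ i).coeff n • v

theorem sgn_smul {A : Type*} [AddCommGroup A] [Module ℂ A] (i k : Fin (M + N)) (x : A) :
    sgn i k • x = (-1 : ℂ) ^ (par M N i * par M N k) • x := by
  rw [← Int.cast_smul_eq_zsmul ℂ]; simp [sgn]

section
variable {V : Type*} [AddCommGroup V] [Module ℂ V] {σ : Module.End ℂ V}
  {T : Fin (M + N) → Fin (M + N) → (Module.End ℂ V)[X]} {v : V} {μ : Fin (M + N) → ℂ[X]}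

theorem IsRealization.pow_mul_coeff (h : IsRealization σ T v μ) (p : ℕ) (i j : Fin (M + N))
    (n : ℕ) : σ ^ p * (T i j).coeff n =
      (-1 : ℂ) ^ (p * (par M N i + par M N j)) • ((T i j).coeff n * σ ^ p) := by
  induction p with
  | zero => simp
  | succ p ih =>
    rw [pow_succ', mul_assoc, ih, mul_smul_comm, ← mul_assoc, h.parity, smul_mul_assoc, smul_smul,
      mul_assoc, ← pow_add]
    congr 2; ring

theorem IsRealization.pow_apply (h : IsRealization σ T v μ) (p : ℕ) : (σ ^ p) v = v := by
  induction p with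
  | zero => rfl
  | succ p ih => rw [pow_succ, Module.End.mul_apply, h.even, ih]

/-- The representation of the super Yangian given by a realization. -/
theorem IsRealization.exists_algHom (h : IsRealization σ T v μ) :
    ∃ φ : SuperYangian M N →ₐ[ℂ] Module.End ℂ V, ∀ a b n, φ (t M N a b n) =
      (-1 : ℂ) ^ (par M N a * par M N b) • ((T a b).coeff n * σ ^ par M N a) := by
  set τ : Fin (M + N) → Fin (M + N) → ℕ → Module.End ℂ V := fun a b n =>
    (-1 : ℂ) ^ (par M N a * par M N b) • ((T a b).coeff n * σ ^ par M N a) with hτ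
  have h0 : ∀ a b, τ a b 0 =
      if a = b then algebraMap ℂ (Module.End ℂ V) ((-1) ^ par M N b) else 0 := by
    intro a b
    simp only [hτ, h.coeff_zero]
    split_ifs with hab
    · subst hab
      rcases par_eq_zero_or_one a with ha | ha <;> simp [ha, h.sq]
    · simp
  have mul : ∀ i j k l m n, τ i j m * τ k l n =
      (-1 : ℂ) ^ (par M N i * par M N j + par M N k * par M N l
        + par M N i * (par M N k + par M N l)) •
      ((T i j).coeff m * (T k l).coeff n * σ ^ (par M N i + par M N k)) := by
    intro i j k l m n
    simp only [hτ]
    rw [smul_mul_smul_comm, mul_assoc _ (σ ^ _), ← mul_assoc (σ ^ _), h.pow_mul_coeff,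
      smul_mul_assoc, mul_smul_comm, smul_smul, mul_assoc _ (σ ^ _), ← pow_add, mul_assoc,
      ← pow_add, ← pow_add]
  refine SuperYangian.exists_algHom τ h0 fun i j k l m n hm hn => ?_
  have key := congrArg (fun z => (-1 : ℂ) ^ (par M N i * par M N j + par M N k * par M N l
    + par M N i * par M N l) • (z * σ ^ (par M N i + par M N k))) (h.rtt.lhsMode_eq i j k l m n)
  have hl : τ i j m * τ k l n
      - (-1 : ℂ) ^ ((par M N i + par M N j) * (par M N k + par M N l)) • (τ k l n * τ i j m) =
      (-1 : ℂ) ^ (par M N i * par M N j + par M N k * par M N l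
        + par M N i * par M N l) • (lhsMode T i j k l m n * σ ^ (par M N i + par M N k)) := by
    rw [mul, mul, lhsMode, sgn_smul, sgn_smul, sub_mul, smul_mul_assoc, smul_mul_assoc, smul_sub,
      smul_smul, smul_smul, smul_smul, add_comm (par M N k) (par M N i), ← pow_add, ← pow_add,
      ← pow_add]
    congr 2 <;> exact neg_one_pow_congr (by grind)
  have hr : ∀ p q, (-1 : ℂ) ^ (par M N i * par M N j + par M N k * par M N l
        + par M N i * par M N l) • (rhsMode T i j k l p q * σ ^ (par M N i + par M N k)) =
      (-1 : ℂ) ^ (par M N i * par M N k + par M N j * (par M N i + par M N k)) •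
        (τ k j p * τ i l q - τ k j q * τ i l p) := by
    intro p q
    rw [mul, mul, rhsMode, sub_mul, ← smul_sub, smul_smul, add_comm (par M N k) (par M N i),
      ← pow_add]
    congr 1
    exact neg_one_pow_congr (by grind)
  simp only [Finset.sum_mul, Finset.smul_sum, hr] at key
  -- The summand `r = 0` contains the constant terms and gives the two linear terms.
  rw [hl, key, Finset.range_eq_Ico, Finset.sum_eq_sum_Ico_succ_bot (lt_min hm hn), Finset.smul_sum,
    h0, h0, zero_add, tsub_zero]
  rw [smul_sub]
  congr 2
  · split_ifs with hkj
    · subst hkj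
      rw [← Algebra.smul_def, smul_smul, ← pow_add, Even.neg_one_pow, one_smul]
      grind
    · simp
  · split_ifs with hil
    · subst hil
      rw [← Algebra.commutes, ← Algebra.smul_def, smul_smul, ← pow_add]
      congr 1
      exact neg_one_pow_congr (by grind)
    · simp

end

open scoped TensorProduct in
/-- Realizations can be tensored, and the weights multiply: in the sum over `c` of
`T_{ic} ⊗ T_{cj}` with `i ≤ j` all terms kill the maximal vector, except `c = i = j`. -/
theorem IsRealization.tensor {V W : Type*} [AddCommGroup V] [Module ℂ V] [AddCommGroup W]
    [Module ℂ W] {σ : Module.End ℂ V} {σ' : Module.End ℂ W}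
    {A : Fin (M + N) → Fin (M + N) → (Module.End ℂ V)[X]}
    {B : Fin (M + N) → Fin (M + N) → (Module.End ℂ W)[X]} {v : V} {w : W}
    {μ ν : Fin (M + N) → ℂ[X]} (h : IsRealization σ A v μ) (h' : IsRealization σ' B w ν) :
    IsRealization (V := V ⊗[ℂ] W) (TensorProduct.map σ σ')
      (fun i j => ∑ c, (A i c).map (Module.End.rTensorAlgHom ℂ V W : _ →+* _) *
        (B c j).map (Module.End.lTensorAlgHom ℂ W V : _ →+* _))
      (v ⊗ₜ w) (fun i => μ i * ν i) := by
  have coeff_eq : ∀ i j n, (∑ c, (A i c).map (Module.End.rTensorAlgHom ℂ V W : _ →+* _) *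
      (B c j).map (Module.End.lTensorAlgHom ℂ W V : _ →+* _)).coeff n =
      ∑ c, ∑ x ∈ Finset.HasAntidiagonal.antidiagonal n,
        TensorProduct.map ((A i c).coeff x.1) ((B c j).coeff x.2) := by
    intro i j n
    simp only [finsetSum_coeff, coeff_mul, coeff_map]
    refine Finset.sum_congr rfl fun c _ => Finset.sum_congr rfl fun x _ => ?_
    exact LinearMap.rTensor_comp_lTensor ..
  have pow_map : ∀ p : ℕ, TensorProduct.map σ σ' ^ p = TensorProduct.map (σ ^ p) (σ' ^ p) :=
    fun p => TensorProduct.map_pow σ σ' p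
  refine ⟨?_, ?_, ?_, ?_, ?_, ?_, ?_, ?_⟩
  · rw [← TensorProduct.map_mul, h.sq, h'.sq, TensorProduct.map_one]
  · refine (h.rtt.map _).mul (h'.rtt.map _) fun i j k l m n => ?_
    simp only [coeff_map]
    exact (LinearMap.rTensor_comp_lTensor ..).trans (LinearMap.lTensor_comp_rTensor ..).symm
  · intro i j n
    rw [coeff_eq]
    simp only [Finset.mul_sum, Finset.sum_mul, Finset.smul_sum, ← TensorProduct.map_mul, h.parity,
      h'.parity, TensorProduct.map_smul_left, TensorProduct.map_smul_right, smul_smul]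
    refine Finset.sum_congr rfl fun c _ => Finset.sum_congr rfl fun x _ => ?_
    congr 1
    rw [← pow_add]
    exact neg_one_pow_congr (by grind)
  · intro i j
    rw [coeff_eq]
    simp only [Finset.HasAntidiagonal.antidiagonal_zero, Finset.sum_singleton,
      h.coeff_zero, h'.coeff_zero]
    rw [Finset.sum_eq_single i]
    · by_cases hij : i = j <;> simp [hij, pow_map]
    · intro c _ hc
      simp [hc.symm]
    · simp
  · intro h0
    have hv : ∃ f : Module.Dual ℂ V, f v ≠ 0 := by
      by_contra! hf; exact h.ne_zero ((Module.forall_dual_apply_eq_zero_iff ℂ v).mp hf)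
    have hw : ∃ f : Module.Dual ℂ W, f w ≠ 0 := by
      by_contra! hf; exact h'.ne_zero ((Module.forall_dual_apply_eq_zero_iff ℂ w).mp hf)
    obtain ⟨f, hf⟩ := hv
    obtain ⟨g, hg⟩ := hw
    have := congrArg (LinearMap.mul' ℂ ℂ ∘ₗ TensorProduct.map f g) h0
    simp [hf, hg] at this
  · simp [h.even, h'.even]
  · intro i j hij n
    rw [coeff_eq]
    simp only [LinearMap.sum_apply, TensorProduct.map_tmul]
    refine Finset.sum_eq_zero fun c _ => Finset.sum_eq_zero fun x _ => ?_
    rcases lt_or_ge i c with hic | hic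
    · rw [h.raise i c hic, TensorProduct.zero_tmul]
    · rw [h'.raise c j (hic.trans_lt hij), TensorProduct.tmul_zero]
  · intro i n
    rw [coeff_eq]
    simp only [LinearMap.sum_apply, TensorProduct.map_tmul]
    rw [Finset.sum_eq_single i]
    · simp only [h.diag, h'.diag, TensorProduct.smul_tmul_smul, ← Finset.sum_smul, coeff_mul]
    · intro c _ hc
      refine Finset.sum_eq_zero fun x _ => ?_
      rcases lt_or_gt_of_ne hc with hic | hic
      · rw [h'.raise c i hic, TensorProduct.tmul_zero]
      · rw [h.raise i c hic, TensorProduct.zero_tmul]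
    · simp

/-! ### Oscillator realizations -/

/-- A matrix of degree one in the spectral parameter satisfies the RTT relation as soon as its
linear coefficients satisfy the commutation relations of `gl(M|N)`. -/
theorem isRTT_of_linear {R : Type*} [Ring R] [Algebra ℂ R] (σ : R)
    (E : Fin (M + N) → Fin (M + N) → R)
    (parity : ∀ i k l, σ ^ par M N i * E k l =
      (-1 : ℂ) ^ (par M N i * (par M N k + par M N l)) • (E k l * σ ^ par M N i))
    (comm : ∀ i j k l, sgn i k • (E i j * E k l) - sgn j l • (E k l * E i j) =
      (if k = j then σ ^ par M N j * E i l else 0) - if i = l then E k j * σ ^ par M N i else 0) :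
    IsRTT fun i j => C (if i = j then σ ^ par M N i else 0) + C (E i j) * X := by
  set T : Fin (M + N) → Fin (M + N) → R[X] :=
    fun i j => C (if i = j then σ ^ par M N i else 0) + C (E i j) * X with hT
  have c0 : ∀ i j, (T i j).coeff 0 = if i = j then σ ^ par M N i else 0 := by
    intro i j; simp [hT]
  have c1 : ∀ i j, (T i j).coeff 1 = E i j := by
    intro i j; simp [hT]
  have c2 : ∀ i j n, (T i j).coeff (n + 2) = 0 := by
    intro i j n; simp [hT]
  have l2 : ∀ i j k l m n, lhsMode T i j k l m (n + 2) = 0 := by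
    intros; simp [lhsMode, c2]
  have l2' : ∀ i j k l m n, lhsMode T i j k l (m + 2) n = 0 := by
    intros; simp [lhsMode, c2]
  have l00 : ∀ i j k l, lhsMode T i j k l 0 0 = 0 := by
    intro i j k l
    simp only [lhsMode, c0]
    split_ifs with hij hkl
    · subst hij; subst hkl; rw [← pow_add, ← pow_add, add_comm, sub_self]
    all_goals simp
  have l01 : ∀ i j k l, lhsMode T i j k l 0 1 = 0 := by
    intro i j k l
    simp only [lhsMode, c0, c1]
    split_ifs with hij
    · subst hij
      rw [parity, sgn_smul, sgn_smul, smul_smul, ← pow_add, sub_eq_zero]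
      congr 1
      exact neg_one_pow_congr (by grind)
    · simp
  have l10 : ∀ i j k l, lhsMode T i j k l 1 0 = 0 := by
    intro i j k l
    simp only [lhsMode, c0, c1]
    split_ifs with hkl
    · subst hkl
      rw [parity, sgn_smul, sgn_smul, smul_smul, ← pow_add, sub_eq_zero]
      congr 1
      exact neg_one_pow_congr (by grind)
    · simp
  have r01 : ∀ i j k l, rhsMode T i j k l 0 1 = lhsMode T i j k l 1 1 := by
    intro i j k l
    simp only [rhsMode, lhsMode, c0, c1, comm, ite_mul, mul_ite, zero_mul, mul_zero]
    congr 1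
    split_ifs with h
    · rw [h]
    · rfl
  rw [isRTT_iff]
  refine fun i j k l => ⟨fun n => ?_, fun m => ?_, fun m n => ?_⟩
  · match n with
    | 0 => exact l00 i j k l
    | 1 => exact l01 i j k l
    | n + 2 => exact l2 i j k l 0 n
  · match m with
    | 0 => exact l00 i j k l
    | 1 => exact l10 i j k l
    | m + 2 => exact l2' i j k l m 0
  · match m, n with
    | 0, 0 => simp [l01, l10, rhsMode]
    | 0, 1 => rw [r01, l2, sub_zero]
    | 1, 0 =>
      have : rhsMode T i j k l 1 0 = - rhsMode T i j k l 0 1 := by simp [rhsMode]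
      rw [this, r01, l2', zero_sub]
    | 1, 1 => rw [l2, l2']; simp [rhsMode]
    | m + 2, n => rw [l2', l2']; simp [rhsMode, c2]
    | 0, n + 2 => rw [l2, l2]; simp [rhsMode, c2]
    | 1, n + 2 => rw [l2, l2]; simp [rhsMode, c2]

/-- Oscillators `x i`, `d i`, where `x i` and `d i` have parity `[i] + [a]` with respect to `σ`. -/
structure IsOscillator {R : Type*} [Ring R] [Algebra ℂ R] (a : Fin (M + N))
    (σ : R) (x d : Fin (M + N) → R) : Prop where
  sq : σ * σ = 1
  σx : ∀ i, σ * x i = (-1 : ℂ) ^ (par M N i + par M N a) • (x i * σ)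
  σd : ∀ i, σ * d i = (-1 : ℂ) ^ (par M N i + par M N a) • (d i * σ)
  xx : ∀ i k, x i * x k =
    (-1 : ℂ) ^ ((par M N i + par M N a) * (par M N k + par M N a)) • (x k * x i)
  dd : ∀ i k, d i * d k =
    (-1 : ℂ) ^ ((par M N i + par M N a) * (par M N k + par M N a)) • (d k * d i)
  dx : ∀ j k, d j * x k = (if k = j then 1 else 0) +
    (-1 : ℂ) ^ ((par M N j + par M N a) * (par M N k + par M N a)) • (x k * d j)

namespace IsOscillator

variable {R : Type*} [Ring R] [Algebra ℂ R] {a : Fin (M + N)} {σ : R} {x d : Fin (M + N) → R}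

theorem pow_mul (h : IsOscillator a σ x d) (p : ℕ) (i j : Fin (M + N)) :
    σ ^ p * (x i * d j) = (-1 : ℂ) ^ (p * (par M N i + par M N j)) • (x i * d j * σ ^ p) := by
  induction p with
  | zero => simp
  | succ p ih =>
    rw [pow_succ', mul_assoc, ih, mul_smul_comm, ← mul_assoc, ← mul_assoc, h.σx, smul_mul_assoc,
      mul_assoc (x i), h.σd, mul_smul_comm, smul_mul_assoc, smul_mul_assoc, smul_smul, smul_smul]
    simp only [mul_assoc, ← pow_succ', ← pow_add]
    congr 1
    exact neg_one_pow_congr (by grind)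

/-- The generators `(-1)^([i][j]) x_i ∂_j σ^[i]`. -/
def gen (σ : R) (x d : Fin (M + N) → R) (i j : Fin (M + N)) : R :=
  (-1 : ℂ) ^ (par M N i * par M N j) • (x i * d j * σ ^ par M N i)

theorem pow_mul_gen (h : IsOscillator a σ x d) (p : ℕ) (k l : Fin (M + N)) :
    σ ^ p * gen σ x d k l =
      (-1 : ℂ) ^ (p * (par M N k + par M N l)) • (gen σ x d k l * σ ^ p) := by
  rw [gen, mul_smul_comm, ← mul_assoc, h.pow_mul, smul_mul_assoc, smul_mul_assoc, smul_smul,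
    smul_smul, mul_comm, mul_assoc _ (σ ^ p), mul_assoc _ (σ ^ _), ← pow_add σ, ← pow_add σ,
    add_comm p]

theorem gen_mul_gen (h : IsOscillator a σ x d) (i j k l : Fin (M + N)) :
    gen σ x d i j * gen σ x d k l =
      (-1 : ℂ) ^ (par M N i * par M N j + par M N k * par M N l
          + par M N i * (par M N k + par M N l)) •
        (if k = j then x i * d l * σ ^ (par M N i + par M N k) else 0) +
      (-1 : ℂ) ^ (par M N i * par M N j + par M N k * par M N l
          + par M N i * (par M N k + par M N l)
          + (par M N j + par M N a) * (par M N k + par M N a)) •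
        (x i * x k * (d j * d l) * σ ^ (par M N i + par M N k)) := by
  rw [gen, gen, smul_mul_smul_comm, mul_assoc _ (σ ^ _), ← mul_assoc (σ ^ _), h.pow_mul,
    smul_mul_assoc, mul_smul_comm, smul_smul, mul_assoc _ (σ ^ _), ← pow_add σ,
    ← mul_assoc (x i * d j), mul_assoc (x i) (d j),
    ← mul_assoc (d j), h.dx, ← pow_add, ← pow_add]
  simp only [mul_add, add_mul, smul_add, mul_smul_comm, smul_mul_assoc, smul_smul, ← pow_add]
  congr 2
  · split_ifs <;> simp
  · simp only [mul_assoc]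

/-- The commutation relations of `gl(M|N)`, in the form without parity signs. -/
theorem comm (h : IsOscillator a σ x d) (i j k l : Fin (M + N)) :
    sgn i k • (gen σ x d i j * gen σ x d k l) - sgn j l • (gen σ x d k l * gen σ x d i j) =
      (if k = j then σ ^ par M N j * gen σ x d i l else 0)
        - if i = l then gen σ x d k j * σ ^ par M N i else 0 := by
  rw [h.gen_mul_gen, h.gen_mul_gen, sgn_smul, sgn_smul, h.xx k i, h.dd l j, h.pow_mul_gen]
  simp only [smul_mul_assoc, mul_smul_comm, smul_smul, smul_add, ← pow_add,
    add_comm (par M N k) (par M N i)]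
  rw [add_sub_add_comm]
  conv_rhs => rw [← add_zero (_ - _)]
  congr 1
  · congr 1
    · split_ifs with hkj
      · subst hkj
        rw [gen, smul_mul_assoc, smul_smul, mul_assoc _ (σ ^ _), ← pow_add, ← pow_add]
        congr 1
        exact neg_one_pow_congr (by grind)
      · simp
    · split_ifs with hil
      · subst hil
        rw [gen, smul_mul_assoc, mul_assoc _ (σ ^ _), ← pow_add, add_comm (par M N k) (par M N i)]
        congr 1
        exact neg_one_pow_congr (by grind)
      · simp
  · rw [sub_eq_zero]
    congr 1
    exact neg_one_pow_congr (by grind)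

end IsOscillator

/-- The operator `f ↦ c · f(· + δ)` on functions of the occupation numbers. -/
def shiftOp (c : (Fin (M + N) → ℤ) → ℂ) (δ : Fin (M + N) → ℤ) :
    Module.End ℂ ((Fin (M + N) → ℤ) → ℂ) where
  toFun f m := c m * f (m + δ)
  map_add' f g := by ext m; simp [mul_add]
  map_smul' r f := by ext m; simp; ring

@[simp] theorem shiftOp_apply (c : (Fin (M + N) → ℤ) → ℂ) (δ : Fin (M + N) → ℤ)
    (f : (Fin (M + N) → ℤ) → ℂ) (m : Fin (M + N) → ℤ) :
    shiftOp c δ f m = c m * f (m + δ) := rfl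

/-- The parity of the oscillators of index `i`, those of index `a` being even. -/
def modePar (a i : Fin (M + N)) : ℕ := par M N i + par M N a

/-- The exponent of the Jordan–Wigner sign of the oscillators of index `i`. -/
def jw (a i : Fin (M + N)) (m : Fin (M + N) → ℤ) : ℤ :=
  modePar a i * ∑ j, if j < i then modePar a j * m j else 0

theorem jw_add_single (a i k : Fin (M + N)) (m : Fin (M + N) → ℤ) (ε : ℤ) :
    jw a k (m + Pi.single i ε) =
      jw a k m + if i < k then modePar a k * (modePar a i * ε) else 0 := by
  have : ∀ j, (if j < k then (modePar a j : ℤ) * (m + Pi.single i ε : Fin (M + N) → ℤ) j else 0) =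
      (if j < k then (modePar a j : ℤ) * m j else 0) +
        if j = i then (if i < k then (modePar a i : ℤ) * ε else 0) else 0 := by
    intro j
    by_cases hj : j = i
    · subst hj
      rw [if_pos rfl]
      split_ifs <;> simp [mul_add]
    · simp [hj]
  simp only [jw, this, Finset.sum_add_distrib, Finset.sum_ite_eq', Finset.mem_univ, if_true,
    mul_add, mul_ite, mul_zero]

theorem neg_one_zpow_mul_odd (p q : ℕ) {ε : ℤ} (hε : Odd ε) :
    (-1 : ℂ) ^ ((p : ℤ) * (q * ε)) = (-1) ^ (p * q) := by
  rw [← mul_assoc, mul_comm, zpow_mul, hε.neg_one_zpow, ← Nat.cast_mul, zpow_natCast]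

theorem neg_one_zpow_mul_self (z : ℤ) : (-1 : ℂ) ^ z * (-1) ^ z = 1 := by
  rw [← mul_zpow]; simp

theorem neg_one_pow_mul_self (n : ℕ) : (-1 : ℂ) ^ n * (-1) ^ n = 1 := by
  rw [← mul_pow]; simp

/-- The operator that changes the occupation number of index `i` by `-ε`, with coefficient `c` and
the Jordan–Wigner sign. -/
def modeOp (a i : Fin (M + N)) (c : ℤ → ℂ) (ε : ℤ) : Module.End ℂ ((Fin (M + N) → ℤ) → ℂ) :=
  shiftOp (fun m => (-1) ^ jw a i m * c (m i)) (Pi.single i ε)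

theorem modeOp_mul_modeOp_of_ne (a : Fin (M + N)) {i k : Fin (M + N)} (hik : i ≠ k)
    (c c' : ℤ → ℂ) {ε ε' : ℤ} (hε : Odd ε) (hε' : Odd ε') :
    modeOp a i c ε * modeOp a k c' ε' =
      (-1 : ℂ) ^ (modePar a i * modePar a k) • (modeOp a k c' ε' * modeOp a i c ε) := by
  ext f m
  have h1 : (m + Pi.single i ε : Fin (M + N) → ℤ) k = m k := by simp [hik.symm]
  have h2 : (m + Pi.single k ε' : Fin (M + N) → ℤ) i = m i := by simp [hik]
  simp only [modeOp, Module.End.mul_apply, shiftOp_apply, LinearMap.smul_apply, Pi.smul_apply,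
    smul_eq_mul, h1, h2, jw_add_single]
  rw [add_right_comm m]
  have hne : (-1 : ℂ) ≠ 0 := by norm_num
  rcases lt_or_gt_of_ne hik with h | h
  · rw [if_pos h, if_neg h.not_gt, add_zero, zpow_add₀ hne, neg_one_zpow_mul_odd _ _ hε,
      mul_comm (modePar a k)]
    ring
  · rw [if_pos h, if_neg h.not_gt, add_zero, zpow_add₀ hne, neg_one_zpow_mul_odd _ _ hε']
    linear_combination (-((-1) ^ jw a i m * c (m i) * ((-1) ^ jw a k m * c' (m k) *
      f (m + Pi.single k ε' + Pi.single i ε)))) * neg_one_pow_mul_self (modePar a i * modePar a k)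

theorem modeOp_mul_modeOp_self (a i : Fin (M + N)) (c c' : ℤ → ℂ) (ε ε' : ℤ) :
    modeOp a i c ε * modeOp a i c' ε' =
      shiftOp (fun m => c (m i) * c' (m i + ε)) (Pi.single i (ε + ε')) := by
  ext f m
  simp only [modeOp, Module.End.mul_apply, shiftOp_apply, jw_add_single, lt_irrefl, if_false,
    add_zero, Pi.add_apply, Pi.single_eq_same, add_assoc, ← Pi.single_add]
  linear_combination (c (m i) * c' (m i + ε) * f (m + Pi.single i (ε + ε'))) *
    neg_one_zpow_mul_self (jw a i m)

/-- The parity operator. -/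
def parityOp (a : Fin (M + N)) : Module.End ℂ ((Fin (M + N) → ℤ) → ℂ) :=
  shiftOp (fun m => (-1) ^ ∑ j, modePar a j * m j) 0

theorem parityOp_mul_self (a : Fin (M + N)) : parityOp a * parityOp a = 1 := by
  ext f m
  simp only [parityOp, Module.End.mul_apply, shiftOp_apply, add_zero, ← mul_assoc,
    neg_one_zpow_mul_self, one_mul, Module.End.one_apply]

theorem parityOp_mul_modeOp (a i : Fin (M + N)) (c : ℤ → ℂ) {ε : ℤ} (hε : Odd ε) :
    parityOp a * modeOp a i c ε = (-1 : ℂ) ^ modePar a i • (modeOp a i c ε * parityOp a) := by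
  ext f m
  have hs : ∑ j, (modePar a j : ℤ) * (m + Pi.single i ε : Fin (M + N) → ℤ) j =
      ∑ j, (modePar a j : ℤ) * m j + modePar a i * ((1 : ℕ) * ε) := by
    simp only [Pi.add_apply, mul_add, Finset.sum_add_distrib]
    congr 1
    rw [Finset.sum_eq_single i] <;> simp +contextual
  simp only [parityOp, modeOp, Module.End.mul_apply, shiftOp_apply, add_zero,
    LinearMap.smul_apply, Pi.smul_apply, smul_eq_mul, hs]
  rw [zpow_add₀ (by norm_num), neg_one_zpow_mul_odd _ _ hε, mul_one]
  linear_combination (-((-1) ^ (∑ j, (modePar a j : ℤ) * m j) * ((-1) ^ jw a i m * c (m i)) *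
    f (m + Pi.single i ε))) * neg_one_pow_mul_self (modePar a i)

/-- The coefficients of the operators `x i`. For `i < a` the state with all occupation numbers `0`
is killed by `x i`. -/
def coeffX (a i : Fin (M + N)) (m : ℤ) : ℂ :=
  if par M N i = par M N a then (if i < a then 1 - m else 1)
  else if i < a then (if Even m then 1 else 0) else (if Even m then 0 else 1)

/-- The coefficients of the operators `d i`. For `i > a` the state with all occupation numbers `0`
is killed by `d i`; for `i = a` it behaves as the power `x_a^s`. -/
def coeffD (a : Fin (M + N)) (s : ℂ) (i : Fin (M + N)) (m : ℤ) : ℂ :=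
  if par M N i = par M N a then (if i < a then -1 else if i = a then m + 1 + s else m + 1)
  else if i < a then (if Even m then 0 else 1) else (if Even m then 1 else 0)

theorem neg_one_pow_modePar_mul_self (a i : Fin (M + N)) :
    (-1 : ℂ) ^ (modePar a i * modePar a i) = if par M N i = par M N a then 1 else -1 := by
  unfold modePar
  rcases par_eq_zero_or_one i with h | h <;> rcases par_eq_zero_or_one a with h' | h' <;>
    simp [h, h', pow_succ]

theorem coeffX_mul (a i : Fin (M + N)) (m : ℤ) : coeffX a i m * coeffX a i (m + -1) =
    (-1 : ℂ) ^ (modePar a i * modePar a i) * (coeffX a i m * coeffX a i (m + -1)) := by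
  rw [neg_one_pow_modePar_mul_self]
  unfold coeffX
  by_cases h : par M N i = par M N a
  · simp [h]
  · simp only [h, if_false, Int.even_add, Int.reduceNeg, even_neg, Int.not_even_one, iff_false]
    split_ifs <;> simp

theorem coeffD_mul (a : Fin (M + N)) (s : ℂ) (i : Fin (M + N)) (m : ℤ) :
    coeffD a s i m * coeffD a s i (m + 1) =
      (-1 : ℂ) ^ (modePar a i * modePar a i) * (coeffD a s i m * coeffD a s i (m + 1)) := by
  rw [neg_one_pow_modePar_mul_self]
  unfold coeffD
  by_cases h : par M N i = par M N a
  · simp [h]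
  · simp only [h, if_false, Int.even_add, Int.not_even_one, iff_false]
    split_ifs <;> simp

theorem coeffD_mul_coeffX (a : Fin (M + N)) (s : ℂ) (i : Fin (M + N)) (m : ℤ) :
    coeffD a s i m * coeffX a i (m + 1) =
      1 + (-1 : ℂ) ^ (modePar a i * modePar a i) * (coeffX a i m * coeffD a s i (m + -1)) := by
  rw [neg_one_pow_modePar_mul_self]
  unfold coeffD coeffX
  by_cases h : par M N i = par M N a
  · simp only [h, if_true]
    split_ifs <;> push_cast <;> ring
  · simp only [h, if_false, Int.even_add, Int.reduceNeg, even_neg, Int.not_even_one, iff_false]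
    split_ifs <;> simp

theorem isOscillator (a : Fin (M + N)) (s : ℂ) :
    IsOscillator a (parityOp a) (fun i => modeOp a i (coeffX a i) (-1))
      (fun i => modeOp a i (coeffD a s i) 1) where
  sq := parityOp_mul_self a
  σx i := parityOp_mul_modeOp a i _ (by decide)
  σd i := parityOp_mul_modeOp a i _ (by decide)
  xx i k := by
    by_cases hik : i = k
    · subst hik
      rw [modeOp_mul_modeOp_self]
      ext f m
      have h := coeffX_mul a i (m i)
      simp only [modePar] at h
      simp only [shiftOp_apply, LinearMap.smul_apply, Pi.smul_apply, smul_eq_mul]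
      linear_combination f _ * h
    · exact modeOp_mul_modeOp_of_ne a hik _ _ (by decide) (by decide)
  dd i k := by
    by_cases hik : i = k
    · subst hik
      rw [modeOp_mul_modeOp_self]
      ext f m
      have h := coeffD_mul a s i (m i)
      simp only [modePar] at h
      simp only [shiftOp_apply, LinearMap.smul_apply, Pi.smul_apply, smul_eq_mul]
      linear_combination f _ * h
    · exact modeOp_mul_modeOp_of_ne a hik _ _ (by decide) (by decide)
  dx j k := by
    by_cases hjk : k = j
    · subst hjk
      rw [modeOp_mul_modeOp_self, modeOp_mul_modeOp_self]
      ext f m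
      have h := coeffD_mul_coeffX a s k (m k)
      simp only [modePar] at h
      simp only [shiftOp_apply, LinearMap.smul_apply, Pi.smul_apply, smul_eq_mul,
        LinearMap.add_apply, Pi.add_apply, if_true, Module.End.one_apply, add_neg_cancel,
        neg_add_cancel, Pi.single_zero, add_zero]
      linear_combination f m * h
    · rw [if_neg hjk, zero_add]
      exact modeOp_mul_modeOp_of_ne a (Ne.symm hjk) _ _ (by decide) (by decide)

/-- The state with all occupation numbers `0`. -/
def vacuum (M N : ℕ) : (Fin (M + N) → ℤ) → ℂ := Pi.single 0 1

theorem vacuum_apply (m : Fin (M + N) → ℤ) : vacuum M N m = if m = 0 then 1 else 0 := by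
  simp [vacuum, Pi.single_apply]

theorem parityOp_vacuum (a : Fin (M + N)) : parityOp a (vacuum M N) = vacuum M N := by
  ext m
  simp only [parityOp, shiftOp_apply, vacuum_apply, add_zero]
  split_ifs with h
  · simp [h]
  · simp

theorem parityOp_pow_vacuum (a : Fin (M + N)) (p : ℕ) :
    (parityOp a ^ p) (vacuum M N) = vacuum M N := by
  induction p with
  | zero => rfl
  | succ p ih => rw [pow_succ, Module.End.mul_apply, parityOp_vacuum, ih]

theorem modeOp_vacuum (a i : Fin (M + N)) (c : ℤ → ℂ) (ε : ℤ) (hc : c (-ε) = 0) :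
    modeOp a i c ε (vacuum M N) = 0 := by
  ext m
  simp only [modeOp, shiftOp_apply, vacuum_apply, Pi.zero_apply]
  split_ifs with h
  · have hm : m i = -ε := by
      have := congrFun h i
      simp at this
      omega
    simp [hm, hc]
  · simp

theorem coeffX_eq_zero {a i : Fin (M + N)} (h : i < a) : coeffX a i 1 = 0 := by
  simp [coeffX, h]

theorem coeffD_eq_zero {a i : Fin (M + N)} (s : ℂ) (h : a < i) : coeffD a s i (-1) = 0 := by
  simp [coeffD, h.not_gt, h.ne']

/-- The vacuum is killed by `x_i ∂_j` for `i < j`: by `∂_j` if `j > a`, and by `x_i` otherwise. -/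
theorem gen_raise (a : Fin (M + N)) (s : ℂ) {i j : Fin (M + N)} (hij : i < j) :
    (modeOp a i (coeffX a i) (-1) * modeOp a j (coeffD a s j) 1) (vacuum M N) = 0 := by
  rcases lt_or_ge a j with haj | haj
  · rw [Module.End.mul_apply, modeOp_vacuum _ _ _ _ (coeffD_eq_zero s haj), map_zero]
  · rw [modeOp_mul_modeOp_of_ne a hij.ne _ _ (by decide) (by decide), LinearMap.smul_apply,
      Module.End.mul_apply, modeOp_vacuum _ _ (coeffX a i), map_zero, smul_zero]
    simpa using coeffX_eq_zero (hij.trans_le haj)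

theorem gen_diag (a : Fin (M + N)) (s : ℂ) (i : Fin (M + N)) :
    (modeOp a i (coeffX a i) (-1) * modeOp a i (coeffD a s i) 1) (vacuum M N) =
      (coeffX a i 0 * coeffD a s i (-1)) • vacuum M N := by
  rw [modeOp_mul_modeOp_self]
  ext m
  simp only [shiftOp_apply, neg_add_cancel, Pi.single_zero, add_zero, vacuum_apply, Pi.smul_apply,
    smul_eq_mul]
  split_ifs with h
  · simp [h]
  · simp

/-- The realization on the Fock space of the oscillators, with the vacuum as maximal vector. -/
theorem isRealization_oscillator (a : Fin (M + N)) (s : ℂ) :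
    IsRealization (parityOp a)
      (fun i j => C (if i = j then parityOp a ^ par M N i else 0) +
        C (IsOscillator.gen (parityOp a) (fun i => modeOp a i (coeffX a i) (-1))
          (fun i => modeOp a i (coeffD a s i) 1) i j) * X)
      (vacuum M N)
      (fun i =>
        1 + C ((-1) ^ (par M N i * par M N i) * (coeffX a i 0 * coeffD a s i (-1))) * X) where
  sq := parityOp_mul_self a
  rtt := isRTT_of_linear _ _ (fun i => (isOscillator a s).pow_mul_gen _) (isOscillator a s).comm
  parity i j n := by
    match n with
    | 0 =>
      simp only [coeff_add, coeff_C_zero, mul_coeff_zero, coeff_X_zero, mul_zero, add_zero]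
      split_ifs with h
      · subst h
        rw [Even.neg_one_pow ⟨_, rfl⟩, one_smul, ← pow_succ, ← pow_succ']
      · simp
    | 1 =>
      have := (isOscillator a s).pow_mul_gen 1 i j
      simpa using this
    | n + 2 => simp
  coeff_zero i j := by simp
  ne_zero := by
    intro h
    have := congrFun h 0
    simp [vacuum_apply] at this
  even := parityOp_vacuum a
  raise i j hij n := by
    match n with
    | 0 => simp [hij.ne]
    | 1 =>
      simp only [coeff_add, coeff_C_succ, coeff_C_mul, coeff_X_one, mul_one, zero_add,
        IsOscillator.gen, LinearMap.smul_apply]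
      rw [Module.End.mul_apply, parityOp_pow_vacuum, gen_raise a s hij, smul_zero]
    | n + 2 => simp
  diag i n := by
    match n with
    | 0 => simp [parityOp_pow_vacuum, -map_pow]
    | 1 =>
      simp only [coeff_add, coeff_C_succ, coeff_C_mul, coeff_X_one, mul_one, zero_add,
        IsOscillator.gen, LinearMap.smul_apply]
      rw [Module.End.mul_apply, parityOp_pow_vacuum, gen_diag, smul_smul]
      simp [coeff_one]
    | n + 2 => simp [coeff_one, -map_pow, -map_mul]

/-! ### Weights that are realized -/

/-- The weight `μ` occurs in some realization. -/
def Realizable (μ : Fin (M + N) → ℂ[X]) : Prop :=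
  ∃ (V : Type) (_ : AddCommGroup V) (_ : Module ℂ V) (σ : Module.End ℂ V)
    (T : Fin (M + N) → Fin (M + N) → (Module.End ℂ V)[X]) (v : V), IsRealization σ T v μ

theorem realizable_one : Realizable fun _ : Fin (M + N) => (1 : ℂ[X]) := by
  refine ⟨ℂ, inferInstance, inferInstance, 1,
    fun i j => C (if i = j then 1 ^ par M N i else 0) + C 0 * X, 1, ?_⟩
  refine ⟨mul_one 1, isRTT_of_linear 1 (fun _ _ => 0) (by simp) (by simp), fun i j n => ?_,
    fun i j => by by_cases h : i = j <;> simp [h], one_ne_zero, rfl,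
    fun i j hij n => by simp [hij.ne], fun i n => ?_⟩
  · by_cases h : i = j
    · subst h; rw [Even.neg_one_pow ⟨_, rfl⟩]; simp
    · simp [h]
  · cases n <;> simp [coeff_one]

theorem Realizable.mul {μ ν : Fin (M + N) → ℂ[X]} (hμ : Realizable μ) (hν : Realizable ν) :
    Realizable fun i => μ i * ν i := by
  obtain ⟨V, _, _, σ, A, v, h⟩ := hμ
  obtain ⟨W, _, _, σ', B, w, h'⟩ := hν
  exact ⟨TensorProduct ℂ V W, inferInstance, inferInstance, _, _, _, h.tensor h'⟩

theorem Realizable.coeff_zero {μ : Fin (M + N) → ℂ[X]} (hμ : Realizable μ) (i : Fin (M + N)) :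
    (μ i).coeff 0 = 1 := by
  obtain ⟨V, _, _, σ, A, v, h⟩ := hμ
  have := h.diag i 0
  rw [h.coeff_zero, if_pos rfl, h.pow_apply] at this
  by_contra hne
  have h2 : (1 - (μ i).coeff 0) • v = 0 := by rw [sub_smul, one_smul, ← this, sub_self]
  exact (smul_eq_zero.mp h2).elim (fun e => hne (sub_eq_zero.mp e).symm) h.ne_zero

theorem exists_realizable_linear (a : Fin (M + N)) (s : ℂ) :
    ∃ μ : Fin (M + N) → ℂ[X], Realizable μ ∧ μ a = 1 + C s * X ∧ ∀ i, a < i → μ i = 1 := by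
  -- The sign cancels the one in the weight of the oscillator realization.
  set s' : ℂ := (-1) ^ (par M N a * par M N a) * s
  refine ⟨_, ⟨_, _, _, _, _, _, isRealization_oscillator a s'⟩, ?_, fun i hi => ?_⟩
  · have : (-1 : ℂ) ^ (par M N a * par M N a) * (coeffX a a 0 * coeffD a s' a (-1)) = s := by
      simp only [coeffX, coeffD, lt_irrefl, if_true, if_false, s']
      linear_combination s * neg_one_pow_mul_self (par M N a * par M N a)
    simp only [this]
  · simp only [coeffD_eq_zero s' hi, mul_zero, map_zero, zero_mul, add_zero]

/-- Every polynomial with constant term `1` is a product of factors `1 + s X`, so it can be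
prescribed at the index `a`. -/
theorem exists_realizable_of_coeff_zero (a : Fin (M + N)) (q : ℂ[X]) (hq : q.coeff 0 = 1) :
    ∃ μ : Fin (M + N) → ℂ[X], Realizable μ ∧ μ a = q ∧ ∀ i, a < i → μ i = 1 := by
  induction hn : q.natDegree generalizing q with
  | zero =>
    obtain ⟨μ, h, ha, hi⟩ := exists_realizable_linear a 0
    refine ⟨μ, h, ?_, hi⟩
    rw [ha, eq_C_of_natDegree_eq_zero hn, hq]; simp
  | succ n ih =>
    have hdeg : q.degree ≠ 0 := by
      intro h0
      have := natDegree_eq_of_degree_eq_some (n := 0) h0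
      omega
    obtain ⟨r, hr⟩ := IsAlgClosed.exists_root q hdeg
    obtain ⟨p, hp⟩ := dvd_iff_isRoot.mpr hr
    have h0 : -r * p.coeff 0 = 1 := by
      rw [← hq, hp]; simp [mul_coeff_zero]
    have hr0 : r ≠ 0 := by rintro rfl; simp at h0
    have hp0 : p ≠ 0 := by rintro rfl; simp at h0
    obtain ⟨μ, hμ, hμa, hμi⟩ := ih (C (-r) * p) (by simpa using h0) (by
      rw [natDegree_C_mul (neg_ne_zero.mpr hr0)]
      rw [hp, natDegree_mul (X_sub_C_ne_zero r) hp0, natDegree_X_sub_C] at hn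
      exact Nat.add_left_cancel (hn.trans (add_comm n 1)))
    obtain ⟨ν, hν, hνa, hνi⟩ := exists_realizable_linear a (-r⁻¹)
    refine ⟨_, hμ.mul hν, ?_, fun i hi => by simp only [hμi i hi, hνi i hi, mul_one]⟩
    simp only [hμa, hνa]
    have hC : (C r * C r⁻¹ : ℂ[X]) = 1 := by rw [← C_mul, mul_inv_cancel₀ hr0, C_1]
    rw [hp, C_neg, C_neg]
    linear_combination (X * p) * hC

/-- Every tuple of power series with constant term `1` agrees with a realized weight up to a given
order. The indices are treated from the last one down: an oscillator realization with a prescribed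
weight at `a` does not change the weights at larger indices. -/
theorem exists_realizable_trunc (ν : Fin (M + N) → PowerSeries ℂ)
    (hν : ∀ i, PowerSeries.constantCoeff (ν i) = 1) (K : ℕ) :
    ∃ μ : Fin (M + N) → ℂ[X], Realizable μ ∧
      ∀ i n, n ≤ K → (μ i).coeff n = PowerSeries.coeff n (ν i) := by
  suffices h : ∀ k ≤ M + N, ∃ μ : Fin (M + N) → ℂ[X], Realizable μ ∧
      ∀ i : Fin (M + N), M + N ≤ i + k → ∀ n ≤ K, (μ i).coeff n = PowerSeries.coeff n (ν i) by
    obtain ⟨μ, hμ, h⟩ := h (M + N) le_rfl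
    exact ⟨μ, hμ, fun i => h i (Nat.le_add_left _ _)⟩
  intro k hk
  induction k with
  | zero => exact ⟨_, realizable_one, fun i hi => absurd hi (by omega)⟩
  | succ k ih =>
    obtain ⟨μ, hμ, hμν⟩ := ih (by omega)
    let a : Fin (M + N) := ⟨M + N - (k + 1), by omega⟩
    have hμ0 : PowerSeries.constantCoeff (μ a : PowerSeries ℂ) ≠ 0 := by
      simp [hμ.coeff_zero a]
    -- The factor that corrects the weight at `a`, up to order `K`.
    set f : PowerSeries ℂ := ν a * (μ a : PowerSeries ℂ)⁻¹ with hf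
    obtain ⟨g, hg, hga, hgi⟩ := exists_realizable_of_coeff_zero a (PowerSeries.trunc (K + 1) f) (by
      simp [PowerSeries.coeff_trunc, hf, hν, hμ.coeff_zero a])
    refine ⟨_, hμ.mul hg, fun i hi n hn => ?_⟩
    rcases Nat.lt_or_ge (i + k) (M + N) with hlt | hge
    · obtain rfl : i = a := Fin.ext (by simp only [a]; omega)
      have hmul : ν a = (μ a : PowerSeries ℂ) * f := by
        rw [hf, mul_left_comm, PowerSeries.mul_inv_cancel _ hμ0, mul_one]
      rw [hga, hmul, coeff_mul, PowerSeries.coeff_mul]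
      refine Finset.sum_congr rfl fun x hx => ?_
      have hx2 : x.2 < K + 1 := by
        rw [Finset.HasAntidiagonal.mem_antidiagonal] at hx; omega
      rw [PowerSeries.coeff_trunc, if_pos hx2, Polynomial.coeff_coe]
    · have hai : a < i := by rw [Fin.lt_def]; simp only [a]; omega
      simp only [hgi i hai, mul_one]
      exact hμν i hge n hn

/-! ### The Verma type module -/

/-- The generators of the left ideal involve finitely many modes at a time, so a given element of
the ideal kills every vector that has the properties of a maximal vector up to some order. -/
theorem exists_order_of_mem_vermaIdeal {Λ : Fin (M + N) → PowerSeries ℂ} {y : SuperYangian M N}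
    (hy : y ∈ vermaIdeal Λ) : ∃ K : ℕ, ∀ (V : Type) [AddCommGroup V] [Module ℂ V]
      (φ : SuperYangian M N →ₐ[ℂ] Module.End ℂ V) (v : V),
      (∀ a b, a < b → ∀ n, φ (t M N a b n) v = 0) →
      (∀ a n, n ≤ K → φ (t M N a a n) v = PowerSeries.coeff n (Λ a) • v) → φ y v = 0 := by
  induction hy using Submodule.span_induction with
  | mem y hy =>
    rcases hy with ⟨a, b, n, hab, hn, rfl⟩ | ⟨a, n, hn, rfl⟩
    · exact ⟨0, fun V _ _ φ v h1 h2 => h1 a b hab n⟩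
    · exact ⟨n, fun V _ _ φ v h1 h2 => by simp [h2 a n le_rfl]⟩
  | zero => exact ⟨0, fun V _ _ φ v h1 h2 => by simp⟩
  | add x y _ _ hx hy =>
    obtain ⟨K, hK⟩ := hx
    obtain ⟨L, hL⟩ := hy
    refine ⟨max K L, fun V _ _ φ v h1 h2 => ?_⟩
    rw [map_add, LinearMap.add_apply,
      hK V φ v h1 fun a n hn => h2 a n (hn.trans (le_max_left _ _)),
      hL V φ v h1 fun a n hn => h2 a n (hn.trans (le_max_right _ _)), add_zero]
  | smul r x _ hx =>
    obtain ⟨K, hK⟩ := hx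
    refine ⟨K, fun V _ _ φ v h1 h2 => ?_⟩
    rw [smul_eq_mul, map_mul, Module.End.mul_apply, hK V φ v h1 h2, map_zero]

theorem one_notMem_vermaIdeal {Λ : Fin (M + N) → PowerSeries ℂ}
    (hΛ : ∀ a, PowerSeries.constantCoeff (Λ a) = (-1 : ℂ) ^ par M N a) :
    (1 : SuperYangian M N) ∉ vermaIdeal Λ := by
  intro h
  obtain ⟨K, hK⟩ := exists_order_of_mem_vermaIdeal h
  obtain ⟨μ, ⟨V, _, _, σ, T, v, hT⟩, hμ⟩ := exists_realizable_trunc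
    (fun a => ((-1 : ℂ) ^ par M N a) • Λ a)
    (fun a => by
      rw [← PowerSeries.coeff_zero_eq_constantCoeff_apply, PowerSeries.coeff_smul,
        PowerSeries.coeff_zero_eq_constantCoeff_apply, hΛ, smul_eq_mul, neg_one_pow_mul_self]) K
  obtain ⟨φ, hφ⟩ := hT.exists_algHom
  refine hT.ne_zero ?_
  have := hK V φ v
    (fun a b hab n => by
      rw [hφ, LinearMap.smul_apply, Module.End.mul_apply, hT.pow_apply, hT.raise a b hab,
        smul_zero])
    (fun a n hn => by
      rw [hφ, LinearMap.smul_apply, Module.End.mul_apply, hT.pow_apply, hT.diag, hμ a n hn,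
        PowerSeries.coeff_smul, smul_eq_mul, smul_smul, ← mul_assoc, ← pow_add,
        Even.neg_one_pow (by grind), one_mul])
  simpa using this

theorem smul_mkQ_one {Λ : Fin (M + N) → PowerSeries ℂ} (y : SuperYangian M N) :
    y • (vermaIdeal Λ).mkQ 1 = (vermaIdeal Λ).mkQ y := by
  rw [← map_smul, smul_eq_mul, mul_one]

theorem exists_smul_mkQ_one {Λ : Fin (M + N) → PowerSeries ℂ} (x : Verma Λ) :
    ∃ y : SuperYangian M N, y • (vermaIdeal Λ).mkQ 1 = x := by
  obtain ⟨y, rfl⟩ := (vermaIdeal Λ).mkQ_surjective x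
  exact ⟨y, smul_mkQ_one y⟩

theorem isMaximalVector_mkQ_one {Λ : Fin (M + N) → PowerSeries ℂ}
    (hΛ : ∀ a, PowerSeries.constantCoeff (Λ a) = (-1 : ℂ) ^ par M N a) :
    IsMaximalVector Λ ((vermaIdeal Λ).mkQ 1) where
  ne_zero h := one_notMem_vermaIdeal hΛ (by simpa using h)
  raise a b hab n hn := by
    rw [smul_mkQ_one, Submodule.mkQ_apply, Submodule.Quotient.mk_eq_zero]
    exact Submodule.subset_span (Or.inl ⟨a, b, n, hab, hn, rfl⟩)
  diag a n hn := by
    rw [smul_mkQ_one, ← algebraMap_smul (SuperYangian M N), smul_mkQ_one, ← sub_eq_zero, ← map_sub,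
      Submodule.mkQ_apply, Submodule.Quotient.mk_eq_zero]
    exact Submodule.subset_span (Or.inr ⟨a, n, hn, rfl⟩)

theorem IsMaximalVector.map {Λ : Fin (M + N) → PowerSeries ℂ} {V W : Type*} [AddCommGroup V]
    [Module ℂ V] [Module (SuperYangian M N) V] [IsScalarTower ℂ (SuperYangian M N) V]
    [AddCommGroup W] [Module ℂ W] [Module (SuperYangian M N) W]
    [IsScalarTower ℂ (SuperYangian M N) W] {v : V} (hv : IsMaximalVector Λ v)
    (f : V →ₗ[SuperYangian M N] W) (hf : f v ≠ 0) : IsMaximalVector Λ (f v) where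
  ne_zero := hf
  raise a b hab n hn := by rw [← map_smul, hv.raise a b hab n hn, map_zero]
  diag a n hn := by rw [← map_smul, hv.diag a n hn, LinearMap.map_smul_of_tower]

section Irreducible

variable {Λ : Fin (M + N) → PowerSeries ℂ}

theorem mkQ_one_notMem_vermaMax
    (hΛ : ∀ a, PowerSeries.constantCoeff (Λ a) = (-1 : ℂ) ^ par M N a) :
    (vermaIdeal Λ).mkQ 1 ∉ vermaMax Λ :=
  (isMaximalVector_mkQ_one hΛ).notMem_sSup exists_smul_mkQ_one

theorem isGreatest_vermaMax
    (hΛ : ∀ a, PowerSeries.constantCoeff (Λ a) = (-1 : ℂ) ^ par M N a) :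
    IsGreatest {P : Submodule (SuperYangian M N) (Verma Λ) | P ≠ ⊤} (vermaMax Λ) :=
  ⟨fun h => mkQ_one_notMem_vermaMax hΛ (h ▸ Submodule.mem_top), fun _ hP => le_sSup hP⟩

theorem isSimpleModule_irrepV
    (hΛ : ∀ a, PowerSeries.constantCoeff (Λ a) = (-1 : ℂ) ^ par M N a) :
    IsSimpleModule (SuperYangian M N) (IrrepV Λ) := by
  rw [isSimpleModule_iff_isCoatom]
  refine ⟨(isGreatest_vermaMax hΛ).1, fun P hP => ?_⟩
  by_contra h
  exact hP.not_ge ((isGreatest_vermaMax hΛ).2 h)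

theorem isMaximalVector_highestVector
    (hΛ : ∀ a, PowerSeries.constantCoeff (Λ a) = (-1 : ℂ) ^ par M N a) :
    IsMaximalVector Λ (highestVector Λ) :=
  (isMaximalVector_mkQ_one hΛ).map (vermaMax Λ).mkQ fun h =>
    mkQ_one_notMem_vermaMax hΛ (by
      rwa [Submodule.mkQ_apply (vermaMax Λ), Submodule.Quotient.mk_eq_zero] at h)

theorem exists_smul_highestVector (x : IrrepV Λ) :
    ∃ y : SuperYangian M N, y • highestVector Λ = x := by
  obtain ⟨z, rfl⟩ := (vermaMax Λ).mkQ_surjective x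
  obtain ⟨y, rfl⟩ := exists_smul_mkQ_one z
  exact ⟨y, (map_smul (vermaMax Λ).mkQ y _).symm⟩

/-- An irreducible module with a maximal vector `v` of weight `Λ` is isomorphic to `V(Λ)`, by an
isomorphism that sends the highest weight vector to `v`. -/
theorem exists_equiv_of_isMaximalVector
    (hΛ : ∀ a, PowerSeries.constantCoeff (Λ a) = (-1 : ℂ) ^ par M N a)
    {V : Type u} [AddCommGroup V] [Module ℂ V] [Module (SuperYangian M N) V]
    [IsScalarTower ℂ (SuperYangian M N) V] [IsSimpleModule (SuperYangian M N) V] {v : V}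
    (hv : IsMaximalVector Λ v) :
    ∃ e : IrrepV Λ ≃ₗ[SuperYangian M N] V, e (highestVector Λ) = v := by
  have hker : vermaIdeal Λ ≤ LinearMap.ker (LinearMap.toSpanSingleton (SuperYangian M N) V v) := by
    refine Submodule.span_le.mpr ?_
    rintro _ (⟨a, b, n, hab, hn, rfl⟩ | ⟨a, n, hn, rfl⟩)
    · simpa using hv.raise a b hab n hn
    · simp [sub_smul, hv.diag a n hn]
  set f : Verma Λ →ₗ[SuperYangian M N] V := (vermaIdeal Λ).liftQ _ hker
  have hf : f ((vermaIdeal Λ).mkQ 1) = v := by simp [f]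
  have hf0 : LinearMap.ker f ≠ ⊤ := fun h => hv.ne_zero (by
    rw [← hf]; exact LinearMap.mem_ker.mp (h ▸ Submodule.mem_top))
  -- A proper submodule cannot map onto `V`: it would contain the generator modulo the kernel.
  have hmax : vermaMax Λ ≤ LinearMap.ker f := by
    rcases eq_bot_or_eq_top ((vermaMax Λ).map f) with h | h
    · exact Submodule.map_le_iff_le_comap.mp h.le
    · obtain ⟨x, hx, hxv⟩ : v ∈ (vermaMax Λ).map f := h ▸ Submodule.mem_top
      refine absurd ?_ (mkQ_one_notMem_vermaMax hΛ)
      have : (vermaIdeal Λ).mkQ 1 - x ∈ LinearMap.ker f := by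
        rw [LinearMap.mem_ker, map_sub, hf, hxv, sub_self]
      exact (Submodule.sub_mem_iff_left _ hx).mp ((isGreatest_vermaMax hΛ).2 hf0 this)
  set g : IrrepV Λ →ₗ[SuperYangian M N] V := (vermaMax Λ).liftQ f hmax
  have hg : g (highestVector Λ) = v := by
    simp only [g, highestVector, Submodule.mkQ_apply (vermaMax Λ), Submodule.liftQ_apply, hf]
  have := isSimpleModule_irrepV hΛ
  have hg0 : g ≠ 0 := fun h => hv.ne_zero (by rw [← hg, h, LinearMap.zero_apply])
  exact ⟨LinearEquiv.ofBijective g (LinearMap.bijective_of_ne_zero hg0), hg⟩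

end Irreducible

/-! ### Gradings -/

theorem exists_parityHom (M N : ℕ) : ∃ θ : SuperYangian M N →ₐ[ℂ] SuperYangian M N,
    ∀ a b n, θ (t M N a b n) = (-1 : ℂ) ^ (par M N a + par M N b) • t M N a b n := by
  refine exists_algHom _ (fun a b => ?_) fun a₁ b₁ a₂ b₂ m n hm hn => ?_
  · rw [t_zero]
    split_ifs with h
    · rw [h, Even.neg_one_pow ⟨_, rfl⟩, one_smul]
    · rw [smul_zero]
  · have key := congrArg
      (fun z => (-1 : ℂ) ^ (par M N a₁ + par M N b₁ + par M N a₂ + par M N b₂) • z)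
      (t_mul_t a₁ b₁ a₂ b₂ hm hn)
    have e1 : (-1 : ℂ) ^ (par M N a₂ + par M N b₂) * (-1) ^ (par M N a₁ + par M N b₁) =
        (-1 : ℂ) ^ (par M N a₁ + par M N b₁ + par M N a₂ + par M N b₂) := by
      rw [← pow_add]; exact neg_one_pow_congr (by grind)
    have e2 : (-1 : ℂ) ^ (par M N a₁ + par M N b₁) * (-1) ^ (par M N a₂ + par M N b₂) =
        (-1 : ℂ) ^ (par M N a₁ + par M N b₁ + par M N a₂ + par M N b₂) := by
      rw [← pow_add]; exact neg_one_pow_congr (by grind)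
    have e3 : (-1 : ℂ) ^ (par M N a₂ + par M N b₁) * (-1) ^ (par M N a₁ + par M N b₂) =
        (-1 : ℂ) ^ (par M N a₁ + par M N b₁ + par M N a₂ + par M N b₂) := by
      rw [← pow_add]; exact neg_one_pow_congr (by grind)
    have d1 : ∀ z : SuperYangian M N, (if a₂ = b₁ then (-1 : ℂ) ^ (par M N a₁ + par M N b₂) • z
        else 0) = (-1 : ℂ) ^ (par M N a₁ + par M N b₁ + par M N a₂ + par M N b₂) •
          if a₂ = b₁ then z else 0 := by
      intro z
      split_ifs with h
      · subst h; congr 1; exact neg_one_pow_congr (by grind)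
      · rw [smul_zero]
    have d2 : ∀ z : SuperYangian M N, (if a₁ = b₂ then (-1 : ℂ) ^ (par M N a₂ + par M N b₁) • z
        else 0) = (-1 : ℂ) ^ (par M N a₁ + par M N b₁ + par M N a₂ + par M N b₂) •
          if a₁ = b₂ then z else 0 := by
      intro z
      split_ifs with h
      · subst h; congr 1; exact neg_one_pow_congr (by grind)
      · rw [smul_zero]
    simp only [smul_mul_smul_comm, e1, e2, e3, d1, d2, ← smul_sub, ← Finset.smul_sum]
    rw [sub_eq_iff_eq_add', key]
    simp only [smul_add, smul_sub, smul_comm ((-1 : ℂ) ^ (par M N a₁ + par M N b₁ + par M N a₂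
      + par M N b₂))]

/-- The parity automorphism of the super Yangian. -/
def parityHom (M N : ℕ) : SuperYangian M N →ₐ[ℂ] SuperYangian M N := (exists_parityHom M N).choose

theorem parityHom_t (a b : Fin (M + N)) (n : ℕ) : parityHom M N (t M N a b n) =
    (-1 : ℂ) ^ (par M N a + par M N b) • t M N a b n :=
  (exists_parityHom M N).choose_spec a b n

theorem parityHom_parityHom (y : SuperYangian M N) : parityHom M N (parityHom M N y) = y := by
  induction y using induction_on with
  | scalar c => simp
  | gen a b n _ =>
    rw [parityHom_t, map_smul, parityHom_t, smul_smul, neg_one_pow_mul_self, one_smul]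
  | add x y hx hy => rw [map_add, map_add, hx, hy]
  | mul x y hx hy => rw [map_mul, map_mul, hx, hy]

/-- The sign `(-1)^i` for `i` modulo `2`. -/
def paritySign (i : ZMod 2) : ℂ := if i = 0 then 1 else -1

@[simp] theorem paritySign_zero : paritySign 0 = 1 := rfl
@[simp] theorem paritySign_one : paritySign 1 = -1 := rfl

theorem zmod_two_cases (i : ZMod 2) : i = 0 ∨ i = 1 := by
  revert i; decide

theorem paritySign_add (i j : ZMod 2) : paritySign (i + j) = paritySign i * paritySign j := by
  rcases zmod_two_cases i with rfl | rfl <;> rcases zmod_two_cases j with rfl | rfl <;>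
    simp [CharTwo.add_self_eq_zero (1 : ZMod 2)]

theorem paritySign_mul_self (i : ZMod 2) : paritySign i * paritySign i = 1 := by
  rcases zmod_two_cases i with rfl | rfl <;> simp

theorem paritySign_natCast (n : ℕ) : paritySign (n : ZMod 2) = (-1) ^ n := by
  induction n with
  | zero => simp
  | succ n ih => rw [Nat.cast_succ, paritySign_add, ih, pow_succ, paritySign_one]

section Grading

variable {V : Type u} [AddCommGroup V] [Module ℂ V] [Module (SuperYangian M N) V]

/-- A parity operator of a `Y(gl(M|N))`-module: an involution that is semilinear for the parity
automorphism. -/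
structure ParityOperator (M N : ℕ) (V : Type u) [AddCommGroup V] [Module ℂ V]
    [Module (SuperYangian M N) V] where
  toMap : V →ₛₗ[(parityHom M N : SuperYangian M N →+* SuperYangian M N)] V
  involutive : ∀ v, toMap (toMap v) = v

namespace ParityOperator

variable (Θ : ParityOperator M N V)

theorem map_smul (y : SuperYangian M N) (v : V) :
    Θ.toMap (y • v) = parityHom M N y • Θ.toMap v :=
  Θ.toMap.map_smulₛₗ y v

theorem half_add_half (v : V) :
    v = (2⁻¹ : ℂ) • (v + Θ.toMap v) + (2⁻¹ : ℂ) • (v - Θ.toMap v) := by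
  module

/-- If the sum of all proper submodules is proper, it is stable under parity operators. -/
theorem map_mem_sSup (hS : sSup {P : Submodule (SuperYangian M N) V | P ≠ ⊤} ≠ ⊤) {v : V}
    (hv : v ∈ sSup {P : Submodule (SuperYangian M N) V | P ≠ ⊤}) :
    Θ.toMap v ∈ sSup {P : Submodule (SuperYangian M N) V | P ≠ ⊤} := by
  set S := sSup {P : Submodule (SuperYangian M N) V | P ≠ ⊤}
  have hne : S.comap Θ.toMap ≠ ⊤ := by
    intro h
    refine hS (top_unique fun w _ => ?_)
    have : Θ.toMap w ∈ S.comap Θ.toMap := h ▸ Submodule.mem_top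
    rwa [Submodule.mem_comap, Θ.involutive] at this
  have hle : S.comap Θ.toMap ≤ S := le_sSup hne
  exact hle (by rwa [Submodule.mem_comap, Θ.involutive])

variable [IsScalarTower ℂ (SuperYangian M N) V]

theorem map_complex_smul (c : ℂ) (v : V) : Θ.toMap (c • v) = c • Θ.toMap v := by
  rw [← algebraMap_smul (SuperYangian M N) c v, Θ.map_smul, AlgHom.commutes, algebraMap_smul]

/-- The homogeneous components for the grading by eigenvalues of a parity operator. -/
def component (i : ZMod 2) : Submodule ℂ V where
  carrier := {v | Θ.toMap v = paritySign i • v}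
  zero_mem' := by simp
  add_mem' := by
    intro v w hv hw
    simp only [Set.mem_ofPred_eq] at hv hw ⊢
    rw [map_add, hv, hw, smul_add]
  smul_mem' := by
    intro c v hv
    simp only [Set.mem_ofPred_eq] at hv ⊢
    rw [Θ.map_complex_smul, hv, smul_comm]

theorem mem_component {i : ZMod 2} {v : V} : v ∈ Θ.component i ↔ Θ.toMap v = paritySign i • v :=
  Iff.rfl

theorem half_add_mem (v : V) : (2⁻¹ : ℂ) • (v + Θ.toMap v) ∈ Θ.component 0 := by
  rw [mem_component, Θ.map_complex_smul, map_add, Θ.involutive, paritySign_zero, one_smul,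
    add_comm]

theorem half_sub_mem (v : V) : (2⁻¹ : ℂ) • (v - Θ.toMap v) ∈ Θ.component 1 := by
  rw [mem_component, Θ.map_complex_smul, map_sub, Θ.involutive, paritySign_one, neg_smul, one_smul,
    ← smul_neg, neg_sub]

theorem isSuperGrading : IsSuperGrading M N Θ.component where
  internal := by
    rw [DirectSum.isInternal_submodule_iff_isCompl _ (zero_ne_one : (0 : ZMod 2) ≠ 1)
      (by ext i; simpa using zmod_two_cases i)]
    constructor
    · rw [Submodule.disjoint_def]
      intro v h0 h1
      rw [mem_component] at h0 h1
      rw [h0, paritySign_zero, paritySign_one, one_smul] at h1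
      have h2 : (2 : ℂ) • v = 0 := by
        rw [two_smul]; nth_rewrite 1 [h1]; simp
      exact (smul_eq_zero.mp h2).resolve_left two_ne_zero
    · rw [codisjoint_iff_le_sup]
      intro v _
      rw [Θ.half_add_half v]
      exact Submodule.add_mem_sup (Θ.half_add_mem v) (Θ.half_sub_mem v)
  smul_mem a b n _ i v hv := by
    rw [mem_component] at hv ⊢
    rw [Θ.map_smul, parityHom_t, hv, paritySign_add, paritySign_natCast, smul_assoc, mul_smul,
      smul_comm (t M N a b n)]

/-- A submodule stable under the parity operator is graded. -/
theorem exists_components {P : Submodule (SuperYangian M N) V} (hP : ∀ v ∈ P, Θ.toMap v ∈ P) {v : V}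
    (hv : v ∈ P) :
    ∃ v₀ ∈ P, ∃ v₁ ∈ P, v₀ ∈ Θ.component 0 ∧ v₁ ∈ Θ.component 1 ∧ v = v₀ + v₁ :=
  ⟨_, P.smul_of_tower_mem _ (P.add_mem hv (hP v hv)), _,
    P.smul_of_tower_mem _ (P.sub_mem hv (hP v hv)), Θ.half_add_mem v, Θ.half_sub_mem v,
    Θ.half_add_half v⟩

theorem isMaximalVector_map {Λ : Fin (M + N) → PowerSeries ℂ} {v : V}
    (hv : IsMaximalVector Λ v) : IsMaximalVector Λ (Θ.toMap v) where
  ne_zero h := hv.ne_zero (by rw [← Θ.involutive v, h, map_zero])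
  raise a b hab n hn := by
    have h := congrArg Θ.toMap (hv.raise a b hab n hn)
    rw [Θ.map_smul, parityHom_t, map_zero, smul_assoc] at h
    exact (smul_eq_zero.mp h).resolve_left (pow_ne_zero _ (by norm_num))
  diag a n hn := by
    have h := congrArg Θ.toMap (hv.diag a n hn)
    rwa [Θ.map_smul, parityHom_t, Even.neg_one_pow ⟨_, rfl⟩, one_smul, Θ.map_complex_smul] at h

/-- A graded module with a maximal vector has a homogeneous maximal vector of the same weight. -/
theorem exists_homogeneous_isMaximalVector {Λ : Fin (M + N) → PowerSeries ℂ} {v : V}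
    (hv : IsMaximalVector Λ v) :
    ∃ (w : V) (j : ZMod 2), IsMaximalVector Λ w ∧ Θ.toMap w = paritySign j • w := by
  have hv' := Θ.isMaximalVector_map hv
  by_cases h : v + Θ.toMap v = 0
  · exact ⟨v, 1, hv, by rw [paritySign_one, neg_one_smul]; exact eq_neg_of_add_eq_zero_right h⟩
  · refine ⟨v + Θ.toMap v, 0, ⟨h, fun a b hab n hn => ?_, fun a n hn => ?_⟩, ?_⟩
    · rw [smul_add, hv.raise a b hab n hn, hv'.raise a b hab n hn, add_zero]
    · rw [smul_add, hv.diag a n hn, hv'.diag a n hn, smul_add]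
    · rw [map_add, Θ.involutive, paritySign_zero, one_smul, add_comm]

end ParityOperator

variable [IsScalarTower ℂ (SuperYangian M N) V]

/-- Every grading is the eigenspace decomposition of a parity operator. -/
theorem IsSuperGrading.exists_parityOperator {𝒱 : ZMod 2 → Submodule ℂ V}
    (h : IsSuperGrading M N 𝒱) : ∃ Θ : ParityOperator M N V, ∀ i, Θ.component i = 𝒱 i := by
  have hc : IsCompl (𝒱 0) (𝒱 1) :=
    (DirectSum.isInternal_submodule_iff_isCompl _ (zero_ne_one : (0 : ZMod 2) ≠ 1)
      (by ext i; simpa using zmod_two_cases i)).mp h.internal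
  set L : V →ₗ[ℂ] V := LinearMap.ofIsCompl hc (𝒱 0).subtype (-(𝒱 1).subtype)
  have hL : ∀ i, ∀ v ∈ 𝒱 i, L v = paritySign i • v := by
    intro i v hv
    rcases zmod_two_cases i with rfl | rfl
    · simpa using LinearMap.ofIsCompl_apply_left hc (φ := (𝒱 0).subtype)
        (ψ := -(𝒱 1).subtype) ⟨v, hv⟩
    · simpa using LinearMap.ofIsCompl_apply_right hc (φ := (𝒱 0).subtype)
        (ψ := -(𝒱 1).subtype) ⟨v, hv⟩
  have hdec : ∀ v : V, ∃ v₀ ∈ 𝒱 0, ∃ v₁ ∈ 𝒱 1, v₀ + v₁ = v := fun v =>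
    Submodule.mem_sup.mp (hc.sup_eq_top ▸ Submodule.mem_top)
  have hsmul : ∀ (y : SuperYangian M N) (v : V), L (y • v) = parityHom M N y • L v := by
    intro y
    induction y using induction_on with
    | scalar c => intro v; rw [algebraMap_smul, AlgHom.commutes, algebraMap_smul, _root_.map_smul]
    | gen a b n hn =>
      have hom : ∀ i, ∀ v ∈ 𝒱 i, L (t M N a b n • v) = parityHom M N (t M N a b n) • L v := by
        intro i v hv
        rw [hL _ _ (h.smul_mem a b n hn i v hv), hL i v hv, parityHom_t, paritySign_add,
          paritySign_natCast, smul_assoc, mul_smul, smul_comm (t M N a b n)]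
      intro v
      obtain ⟨v₀, h₀, v₁, h₁, rfl⟩ := hdec v
      rw [smul_add, map_add, map_add, smul_add, hom 0 v₀ h₀, hom 1 v₁ h₁]
    | add x y hx hy => intro v; rw [add_smul, map_add, hx, hy, map_add, add_smul]
    | mul x y hx hy => intro v; rw [mul_smul, hx, hy, map_mul, mul_smul]
  have hinv : ∀ v, L (L v) = v := by
    intro v
    obtain ⟨v₀, h₀, v₁, h₁, rfl⟩ := hdec v
    rw [map_add, hL 0 v₀ h₀, hL 1 v₁ h₁, map_add, _root_.map_smul, _root_.map_smul, hL 0 v₀ h₀,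
      hL 1 v₁ h₁]
    simp
  let Θ : ParityOperator M N V :=
    ⟨{ toFun := L, map_add' := map_add L, map_smul' := hsmul }, hinv⟩
  refine ⟨Θ, fun i => le_antisymm (fun v hv => ?_) fun v hv => hL i v hv⟩
  have hv : L v = paritySign i • v := hv
  obtain ⟨v₀, h₀, v₁, h₁, rfl⟩ := hdec v
  rw [map_add, hL 0 v₀ h₀, hL 1 v₁ h₁] at hv
  rcases zmod_two_cases i with rfl | rfl
  · have : v₁ = 0 := by
      have h2 : (2 : ℂ) • v₁ = 0 := by
        simp only [paritySign_zero, paritySign_one] at hv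
        rw [← sub_eq_zero.mpr hv.symm]; module
      exact (smul_eq_zero.mp h2).resolve_left two_ne_zero
    rw [this, add_zero]; exact h₀
  · have : v₀ = 0 := by
      have h2 : (2 : ℂ) • v₀ = 0 := by
        simp only [paritySign_zero, paritySign_one] at hv
        rw [← sub_eq_zero.mpr hv]; module
      exact (smul_eq_zero.mp h2).resolve_left two_ne_zero
    rw [this, zero_add]; exact h₁

variable {Λ : Fin (M + N) → PowerSeries ℂ}

/-- The parity automorphism preserves the left ideal of the Verma type module and the greatest
proper submodule, and so descends to `V(Λ)`. -/
theorem exists_parityOperator_irrepV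
    (hΛ : ∀ a, PowerSeries.constantCoeff (Λ a) = (-1 : ℂ) ^ par M N a) :
    ∃ Θ : ParityOperator M N (IrrepV Λ), Θ.toMap (highestVector Λ) = highestVector Λ := by
  let L : SuperYangian M N →ₛₗ[(parityHom M N : SuperYangian M N →+* SuperYangian M N)]
      SuperYangian M N :=
    { toFun := parityHom M N
      map_add' := map_add _
      map_smul' := fun y z => map_mul (parityHom M N) y z }
  have hL : vermaIdeal Λ ≤ (vermaIdeal Λ).comap L := by
    refine Submodule.span_le.mpr ?_
    rintro _ (⟨a, b, n, hab, hn, rfl⟩ | ⟨a, n, hn, rfl⟩)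
    · change parityHom M N _ ∈ vermaIdeal Λ
      rw [parityHom_t]
      exact (vermaIdeal Λ).smul_of_tower_mem _
        (Submodule.subset_span (Or.inl ⟨a, b, n, hab, hn, rfl⟩))
    · change parityHom M N _ ∈ vermaIdeal Λ
      rw [map_sub, parityHom_t, Even.neg_one_pow ⟨_, rfl⟩, one_smul, AlgHom.commutes]
      exact Submodule.subset_span (Or.inr ⟨a, n, hn, rfl⟩)
  let Θ₁ : ParityOperator M N (Verma Λ) :=
    ⟨(vermaIdeal Λ).mapQ (vermaIdeal Λ) L hL, fun v => by
      obtain ⟨y, rfl⟩ := (vermaIdeal Λ).mkQ_surjective v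
      exact congrArg (vermaIdeal Λ).mkQ (parityHom_parityHom y)⟩
  have h₁ : Θ₁.toMap ((vermaIdeal Λ).mkQ 1) = (vermaIdeal Λ).mkQ 1 :=
    congrArg (vermaIdeal Λ).mkQ (map_one (parityHom M N))
  have hmax : vermaMax Λ ≤ (vermaMax Λ).comap Θ₁.toMap := fun v hv =>
    Θ₁.map_mem_sSup (isGreatest_vermaMax hΛ).1 hv
  exact ⟨⟨(vermaMax Λ).mapQ (vermaMax Λ) Θ₁.toMap hmax, fun v => by
      obtain ⟨y, rfl⟩ := (vermaMax Λ).mkQ_surjective v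
      exact congrArg (vermaMax Λ).mkQ (Θ₁.involutive y)⟩,
    congrArg (vermaMax Λ).mkQ h₁⟩

/-- An irreducible graded module generated by a homogeneous maximal vector is irreducible: the sum
of its proper submodules is proper and graded. -/
theorem isSimpleModule_of_isGradedIrreducible {Θ : ParityOperator M N V}
    (hirr : IsGradedIrreducible M N Θ.component) {w : V} {j : ZMod 2}
    (hw : IsMaximalVector Λ w) (hj : Θ.toMap w = paritySign j • w) :
    IsSimpleModule (SuperYangian M N) V := by
  have hspan : Submodule.span (SuperYangian M N) {w} = ⊤ := by
    refine (hirr.eq_bot_or_eq_top _ fun v hv => Θ.exists_components ?_ hv).resolve_left ?_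
    · intro v hv
      obtain ⟨y, rfl⟩ := Submodule.mem_span_singleton.mp hv
      rw [Θ.map_smul, hj]
      exact Submodule.smul_mem _ _ (Submodule.smul_of_tower_mem _ _
        (Submodule.mem_span_singleton_self w))
    · rw [Submodule.span_singleton_eq_bot]; exact hw.ne_zero
  have hgen : ∀ x : V, ∃ y : SuperYangian M N, y • w = x := fun x =>
    Submodule.mem_span_singleton.mp (hspan ▸ Submodule.mem_top)
  set S := sSup {P : Submodule (SuperYangian M N) V | P ≠ ⊤}
  have hS : S ≠ ⊤ := fun h => hw.notMem_sSup hgen (by change w ∈ S; rw [h]; trivial)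
  have hS0 : S = ⊥ := (hirr.eq_bot_or_eq_top S fun v hv =>
    Θ.exists_components (fun _ => Θ.map_mem_sSup hS) hv).resolve_right hS
  have := hirr.nontrivial
  rw [isSimpleModule_iff]
  exact { eq_bot_or_eq_top := fun P => by
            by_contra! h
            exact h.1 (bot_unique (hS0 ▸ le_sSup h.2)) }

end Grading

end SuperYangian
end

open SuperYangian in
theorem mainTheorem3 (M N : ℕ) (Λ : Fin (M + N) → PowerSeries ℂ)
    (hΛ : ∀ a : Fin (M + N),
      PowerSeries.constantCoeff (Λ a) = (-1 : ℂ) ^ SuperYangian.par M N a) :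
    -- The Verma type module has a unique maximal proper submodule.
    IsGreatest {P : Submodule (SuperYangian M N) (SuperYangian.Verma Λ) | P ≠ ⊤}
        (SuperYangian.vermaMax Λ) ∧
    -- The quotient by it is an irreducible highest weight module with highest weight `Λ(x)`.
    SuperYangian.IsIrreducibleHighestWeight Λ (SuperYangian.IrrepV Λ) ∧
    SuperYangian.IsMaximalVector Λ (SuperYangian.highestVector Λ) ∧
    -- It is unique up to isomorphism.
    (∀ (V : Type u) [AddCommGroup V] [Module ℂ V] [Module (SuperYangian M N) V]
        [IsScalarTower ℂ (SuperYangian M N) V],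
      SuperYangian.IsIrreducibleHighestWeight Λ V →
        Nonempty (SuperYangian.IrrepV Λ ≃ₗ[SuperYangian M N] V)) ∧
    -- The same for graded modules, uniqueness being up to isomorphism and parity shift.
    (∃ 𝒲 : ZMod 2 → Submodule ℂ (SuperYangian.IrrepV Λ),
      SuperYangian.IsGradedIrreducible M N 𝒲 ∧ SuperYangian.highestVector Λ ∈ 𝒲 0 ∧
      ∀ (V : Type u) [AddCommGroup V] [Module ℂ V] [Module (SuperYangian M N) V]
        [IsScalarTower ℂ (SuperYangian M N) V] (𝒱 : ZMod 2 → Submodule ℂ V),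
        SuperYangian.IsGradedIrreducible M N 𝒱 →
        (∃ v : V, SuperYangian.IsMaximalVector Λ v) →
          ∃ (e : SuperYangian.IrrepV Λ ≃ₗ[SuperYangian M N] V) (j : ZMod 2),
            ∀ (i : ZMod 2) (w : SuperYangian.IrrepV Λ), w ∈ 𝒲 i ↔ e w ∈ 𝒱 (i + j)) := by
  refine ⟨isGreatest_vermaMax hΛ,
    ⟨isSimpleModule_irrepV hΛ, _, isMaximalVector_highestVector hΛ⟩,
    isMaximalVector_highestVector hΛ, ?_, ?_⟩
  · intro V _ _ _ _ hV
    obtain ⟨v, hv⟩ := hV.exists_maximalVector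
    have := hV.irreducible
    obtain ⟨e, -⟩ := exists_equiv_of_isMaximalVector hΛ hv
    exact ⟨e⟩
  · obtain ⟨Θ, hΘ⟩ := exists_parityOperator_irrepV hΛ
    have hsimple := isSimpleModule_irrepV hΛ
    refine ⟨Θ.component, ⟨Θ.isSuperGrading, IsSimpleModule.nontrivial (SuperYangian M N) _,
      fun P _ => eq_bot_or_eq_top P⟩, ?_, ?_⟩
    · rw [Θ.mem_component, hΘ, paritySign_zero, one_smul]
    · rintro V _ _ _ _ 𝒱 h𝒱 ⟨v, hv⟩
      obtain ⟨Θ', hΘ'⟩ := h𝒱.grading.exists_parityOperator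
      obtain rfl : Θ'.component = 𝒱 := funext hΘ'
      obtain ⟨w, j, hw, hwj⟩ := Θ'.exists_homogeneous_isMaximalVector hv
      have := isSimpleModule_of_isGradedIrreducible h𝒱 hw hwj
      obtain ⟨e, he⟩ := exists_equiv_of_isMaximalVector hΛ hw
      -- Both sides are semilinear in `x` and agree on the highest weight vector.
      have heΘ : ∀ x, Θ'.toMap (e x) = paritySign j • e (Θ.toMap x) := by
        intro x
        obtain ⟨y, rfl⟩ := exists_smul_highestVector x
        rw [map_smul, he, Θ'.map_smul, hwj, Θ.map_smul, hΘ, map_smul, he, smul_comm]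
      refine ⟨e, j, fun i x => ?_⟩
      rw [Θ.mem_component, Θ'.mem_component, heΘ, paritySign_add, mul_comm, mul_smul,
        ← e.injective.eq_iff]
      have hs : e (paritySign i • x) = paritySign i • e x :=
        LinearMap.map_smul_of_tower (e : IrrepV Λ →ₗ[SuperYangian M N] V) _ x
      rw [hs]
      refine ⟨fun h => by rw [h], fun h => ?_⟩
      have h2 := congrArg (paritySign j • ·) h
      simpa only [smul_smul, paritySign_mul_self, one_smul, one_mul, ← mul_assoc] using h2
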